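/- Let $d\ge 2$, let $\mathcal L:\mathbb R^d\to\mathbb R$ be differentiable with $Z=\int e^{-\mathcal L(x)}\,dx<\infty$, and let $p(x)=e^{-\mathcal L(x)}/Z$ be the target distribution. Fix a step size $\epsilon>0$, a partial refreshment parameter $L_{\mathrm{partial}}>0$ and a number of steps $n$. For a position $x$ put $e=-\nabla\mathcal L(x)/\|\nabla\mathcal L(x)\|$ and $\delta_\epsilon=\epsilon\|\nabla\mathcal L(x)\|/(d-1)$, and for $z=(x,u)$ define $$A_\epsilon(x,u)=(x+\epsilon u,\,u),\qquad B_\epsilon(x,u)=\Big(x,\ \frac{u+(\sinh\delta_\epsilon+(e\cdot u)(\cosh\delta_\epsilon-1))\,e}{\cosh\delta_\epsilon+(e\cdot u)\sinh\delta_\epsilon}\Big)$$ ($B_\epsilon$ is the identity where $\nabla\mathcal L(x)=0$), $\Phi_\epsilon=B_{\epsilon/2}\circ A_\epsilon\circ B_{\epsilon/2}$, and let the energy error $\Delta(\Phi_\epsilon(z),z)$ be the sum of the energy changes of these three updates, where $A_\epsilon$ contributes $-\log\big(p(x')/p(x)\big)=\mathcal L(x')-\mathcal L(x)$, with $x'$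 the new position, and $B_\epsilon$ contributes $(d-1)\log(\cosh\delta_\epsilon+(e\cdot u)\sinh\delta_\epsilon)$, each evaluated at the point at which the update is applied. The partial refreshment is $$O_\epsilon(x,u)=\Big(x,\ \frac{c_1u+c_2 Y/\sqrt d}{\|c_1u+c_2 Y/\sqrt d\|}\Big),\qquad c_1=e^{-\epsilon/L_{\mathrm{partial}}},\quad c_2=\sqrt{1-c_1^2},$$ with a fresh standard normal vector $Y$ in $\mathbb R^d$ at each use. Consider the MAMS-Langevin algorithm: from the position $x_I$, draw $u$ uniformly on the unit sphere $S^{d-1}$, set $z^0=(x_I,u)$ and $\delta=0$; for $i=0,\dots,n-1$ set $z=O_\epsilon(z^i)$, $z'=\Phi_\epsilon(z)$, $z^{i+1}=O_\epsilon(z')$ and add $\Delta(z',z)$ to $\delta$; draw $U$ uniformly on $(0,1)$, let $x_{I+1}$ be the position of $z^n$ if $U<e^{-\delta}$, and let $x_{I+1}=x_I$ otherwise. All random draws are independent of each other and of the initial position $x_0$. Then $\{x_I\}_{I\ge0}$ is a time-homogeneous Markov chain on $\mathbb R^d$, whose transition kernel (the law of one iteration of the algorithm) is reversible with respect to $p$;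 in particular $p$ is a stationary distribution of the chain. -/

import Mathlib

open MeasureTheory ProbabilityTheory

noncomputable section

namespace MAMS

/-- The position space `ℝᵈ` with its Euclidean norm. -/
abbrev Pos (d : ℕ) : Type := EuclideanSpace ℝ (Fin d)

/-- Phase space: pairs `z = (x, u)` of a position and a velocity. Velocities are vectors of `ℝᵈ`;
the algorithm draws them on the unit sphere, and all the updates below keep the norm equal to one
(the partial refreshment does so almost surely). -/
abbrev Phase (d : ℕ) : Type := Pos d × Pos d

/-- The target distribution `p(x) = exp (-𝓛 x) / Z`, where `Z = ∫ exp (-𝓛 x) dx`. -/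
def target {d : ℕ} (L : Pos d → ℝ) : Measure (Pos d) :=
  volume.withDensity fun x => ENNReal.ofReal (Real.exp (-L x) / ∫ y, Real.exp (-L y))

/-- The uniform distribution on the unit sphere of `ℝᵈ` (normalized surface measure), as a
distribution on `ℝᵈ`. -/
def uniformSphere (d : ℕ) : Measure (Pos d) :=
  (((volume : Measure (Pos d)).toSphere Set.univ)⁻¹ • (volume : Measure (Pos d)).toSphere).map
    (Subtype.val : Metric.sphere (0 : Pos d) 1 → Pos d)

section Integrator

variable {d : ℕ} (L : Pos d → ℝ)

/-- The position update `A_ε`. -/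
def updateA (ε : ℝ) (z : Phase d) : Phase d := (z.1 + ε • z.2, z.2)

/-- The direction `e = -∇𝓛(x) / ‖∇𝓛(x)‖`. Where the gradient vanishes this is `0`, and the velocity
update below is then the identity, as it is for the differential equation. -/
def dir (x : Pos d) : Pos d := -(‖gradient L x‖⁻¹ • gradient L x)

/-- `δ = ε ‖∇𝓛(x)‖ / (d - 1)`. -/
def rapidity (ε : ℝ) (x : Pos d) : ℝ := ε * ‖gradient L x‖ / ((d : ℝ) - 1)

/-- `cosh δ + (e · u) sinh δ`. -/
def stretch (ε : ℝ) (z : Phase d) : ℝ :=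
  Real.cosh (rapidity L ε z.1) + inner ℝ (dir L z.1) z.2 * Real.sinh (rapidity L ε z.1)

/-- The microcanonical velocity update `B_ε`, that is, the time-`ε` solution of
`u' = -(I - u uᵀ) ∇𝓛(x) / (d - 1)` at fixed position. -/
def updateB (ε : ℝ) (z : Phase d) : Phase d :=
  (z.1, (stretch L ε z)⁻¹ •
    (z.2 + (Real.sinh (rapidity L ε z.1)
      + inner ℝ (dir L z.1) z.2 * (Real.cosh (rapidity L ε z.1) - 1)) • dir L z.1))

/-- The change of potential energy `-log (p(x') / p(x)) = 𝓛(x') - 𝓛(x)` in the update `A_ε`. -/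
def deltaV (ε : ℝ) (z : Phase d) : ℝ := L (updateA ε z).1 - L z.1

/-- The change of kinetic energy `(d - 1) log (cosh δ + (e · u) sinh δ)` in the update `B_ε`. -/
def deltaK (ε : ℝ) (z : Phase d) : ℝ := ((d : ℝ) - 1) * Real.log (stretch L ε z)

/-- One deterministic step `Φ_ε = B_{ε/2} ∘ A_ε ∘ B_{ε/2}`. -/
def leapfrog (ε : ℝ) (z : Phase d) : Phase d :=
  updateB L (ε / 2) (updateA ε (updateB L (ε / 2) z))

/-- The energy error `Δ(Φ_ε(z), z)`: the sum of the energy changes of the three updates. -/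
def energyError (ε : ℝ) (z : Phase d) : ℝ :=
  deltaK L (ε / 2) z + deltaV L ε (updateB L (ε / 2) z)
    + deltaK L (ε / 2) (updateA ε (updateB L (ε / 2) z))

end Integrator

section Algorithm

variable {d : ℕ}

/-- The partial velocity refreshment
`O_ε(u) = (c₁ u + c₂ g / √d) / ‖c₁ u + c₂ g / √d‖`, with `c₁ = exp (-ε / Lp)`, `c₂ = √(1 - c₁²)`
and `g` the value of a standard normal vector; the position is not changed. -/
def partialRefresh (ε Lp : ℝ) (g : Pos d) (z : Phase d) : Phase d :=
  let c₁ := Real.exp (-ε / Lp)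
  let c₂ := √(1 - c₁ ^ 2)
  let v := c₁ • z.2 + (c₂ / √(d : ℝ)) • g
  (z.1, ‖v‖⁻¹ • v)

/-- `n` steps of the scheme `O Φ O` from a phase point `z`, where the `i`-th step uses the two normal
vectors `g i`. The result is the final phase point with the accumulated energy error of
the deterministic parts. -/
def trajectory (L : Pos d → ℝ) (ε Lp : ℝ) :
    (n : ℕ) → (Fin n → Pos d × Pos d) → Phase d → Phase d × ℝ
  | 0, _, z => (z, 0)
  | n + 1, g, z =>
    let r := trajectory L ε Lp n (fun i => g i.castSucc) z
    let y := partialRefresh ε Lp (g (Fin.last n)).1 r.1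
    (partialRefresh ε Lp (g (Fin.last n)).2 (leapfrog L ε y), r.2 + energyError L ε y)

/-- The random draws of one iteration of the algorithm: the fresh velocity, two normal vectors for
each of the `n` steps, and the variable that decides on acceptance. -/
abbrev Noise (d n : ℕ) : Type := Pos d × (Fin n → Pos d × Pos d) × ℝ

/-- The law of the random draws of one iteration: they are independent, the velocity is uniform on
the sphere, the vectors are standard normal and the last variable is uniform on `(0, 1)`. -/
def noiseLaw (d n : ℕ) : Measure (Noise d n) :=
  (uniformSphere d).prod
    ((Measure.pi fun _ : Fin n => (stdGaussian (Pos d)).prod (stdGaussian (Pos d))).prod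
      (volume.restrict (Set.Ioo (0 : ℝ) 1)))

open Classical in
/-- One iteration of the algorithm from the position `x`, with the random draws `ξ = (u, g, U)`: run
the trajectory from `(x, u)` and move to its final position if `U < exp (-δ)`. -/
def step (L : Pos d → ℝ) (ε Lp : ℝ) (n : ℕ) (x : Pos d) (ξ : Noise d n) : Pos d :=
  let r := trajectory L ε Lp n ξ.2.1 (x, ξ.1)
  if ξ.2.2 < Real.exp (-r.2) then r.1.1 else x

/-- The positions produced by the algorithm from the initial position `x₀ ω`, with the random draws
`ξ I ω` in iteration `I`. -/
def positions {Ω : Type*} (L : Pos d → ℝ) (ε Lp : ℝ) (n : ℕ) (x₀ : Ω → Pos d)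
    (ξ : ℕ → Ω → Noise d n) : ℕ → Ω → Pos d
  | 0, ω => x₀ ω
  | I + 1, ω => step L ε Lp n (positions L ε Lp n x₀ ξ I ω) (ξ I ω)

/-- The random input of the algorithm on a probability space: an initial position (for instance a
deterministic one), and independent draws for the iterations, independent of the initial
position, with the prescribed law. -/
structure IsInput {Ω : Type*} [MeasurableSpace Ω] (P : Measure Ω) {n : ℕ} (x₀ : Ω → Pos d)
    (ξ : ℕ → Ω → Noise d n) : Prop where
  measurable_init : Measurable x₀
  measurable_noise : ∀ I, Measurable (ξ I)
  map_noise : ∀ I, P.map (ξ I) = noiseLaw d n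
  iIndepFun_noise : iIndepFun ξ P
  indepFun_init : IndepFun x₀ (fun ω I => ξ I ω) P

end Algorithm

/-- `X` is a (time-homogeneous) Markov chain with transition kernel `κ`: the conditional
distribution of `X (i + 1)` given `X 0, …, X i` is `κ (X i)`. -/
structure IsMarkovChain {Ω E : Type*} [MeasurableSpace Ω] [MeasurableSpace E] (X : ℕ → Ω → E)
    (κ : Kernel E E) (P : Measure Ω) : Prop where
  measurable : ∀ i, Measurable (X i)
  condExp_eq : ∀ (i : ℕ) (A : Set E), MeasurableSet A →
    P[(X (i + 1) ⁻¹' A).indicator (fun _ => (1 : ℝ)) |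
        ⨆ j ∈ Set.Iic i, MeasurableSpace.comap (X j) inferInstance]
      =ᵐ[P] fun ω => (κ (X i ω)).real A

end MAMS

end

/-! Append to phase space a real coordinate `v` carrying Lebesgue measure, and let every update with
energy change `Δ` multiply `v` by `exp Δ`. The scaling supplies exactly the factor that the update
lacks to preserve the target times the uniform law on the sphere, so `extA` and `extB` preserve
`extMeasure`. For `A` the factor is a quotient of target densities, and translation invariance
suffices. For `B` it is a Jacobian on the sphere: the update is the action of a Lorentz boost on the
directions of the light cone, and `lintegral_boostDir` reads the Jacobian off the determinant of the
boost on `ℝᵈ` in polar coordinates.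

Let `J` reverse the velocity. Both maps satisfy `M J M = J` (almost everywhere for `B`), so
composition with `M` is adjoint to its own conjugate by `J` (`skewAdjoint_comp_right`). The
refreshment has this property too, because its density on the sphere depends only on the inner
product of the old and new velocities (`exists_density_direction`). Composition reverses the order
of factors (`SkewAdjoint.comp`), so the palindromes `B A B` and `O Φ O`, and the powers of the
latter, inherit the property.

For `U` in `(0, 1)`, the test `U < exp (-δ)` says that `U exp δ` lies in `(0, 1)`. Thus `U` is the
initial value of `v`, and acceptance means that `v` ends in the unit interval. The accepted flow
from `A` to `B` is the pairing of `slab A` with the `n`-step operator applied to `slab B`. Slabs are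
invariant under `J`, so this is symmetric in `A` and `B`; rejected moves contribute a term on `A ∩
B`. The Markov property holds because the draws of each iteration are independent of the past. -/

noncomputable section

namespace MAMS

/-! ### Surface measure and polar coordinates. -/

section Sphere

variable {E : Type*} [NormedAddCommGroup E] [InnerProductSpace ℝ E] [FiniteDimensional ℝ E]
  [MeasurableSpace E] [BorelSpace E]

variable (E) in
/-- The surface measure of the unit sphere, as a measure on the ambient space. -/
def sphereMeasure : Measure E :=
  (volume : Measure E).toSphere.map (Subtype.val : Metric.sphere (0 : E) 1 → E)

instance : IsFiniteMeasure (sphereMeasure E) := by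
  unfold sphereMeasure; infer_instance

variable (E) in
lemma ae_norm_eq_one_sphereMeasure : ∀ᵐ u ∂sphereMeasure E, ‖u‖ = 1 := by
  unfold sphereMeasure
  rw [ae_map_iff measurable_subtype_coe.aemeasurable
    (measurableSet_eq_fun measurable_norm measurable_const)]
  exact Filter.Eventually.of_forall fun u => by simp

/-- Integration in polar coordinates. -/
lemma lintegral_polar [Nontrivial E] {f : E → ENNReal} (hf : Measurable f) :
    ∫⁻ w, f w = ∫⁻ u, ∫⁻ r, f ((r : ℝ) • u)
      ∂(Measure.volumeIoiPow (Module.finrank ℝ E - 1)) ∂(sphereMeasure E) := by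
  have hm : Measurable fun q : E × Set.Ioi (0 : ℝ) => f ((q.2 : ℝ) • q.1) := by fun_prop
  have h1 := (volume : Measure E).measurePreserving_homeomorphUnitSphereProd.lintegral_comp_emb
    (Homeomorph.measurableEmbedding _)
    (fun q => f ((homeomorphUnitSphereProd E).symm q : E))
  simp only [Homeomorph.symm_apply_apply] at h1
  -- Polar coordinates are a homeomorphism of the punctured space only, so the null origin is
  -- removed first.
  rw [sphereMeasure, lintegral_map hm.lintegral_prod_right' measurable_subtype_coe,
    ← restrict_compl_singleton (μ := (volume : Measure E)) 0,
    ← lintegral_subtype_comap (measurableSet_singleton (0 : E)).compl, h1, lintegral_prod]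
  · simp
  · refine Measurable.aemeasurable ?_
    exact hf.comp (measurable_subtype_coe.comp (homeomorphUnitSphereProd E).symm.measurable)

omit [FiniteDimensional ℝ E] [MeasurableSpace E] [BorelSpace E] in
lemma norm_inv_smul_smul {r : ℝ} (hr : 0 < r) {u : E} (hu : ‖u‖ = 1) :
    ‖r • u‖⁻¹ • (r • u) = u := by
  rw [norm_smul, hu, mul_one, Real.norm_of_nonneg hr.le, smul_smul, inv_mul_cancel₀ hr.ne',
    one_smul]

/-- The integral of a function of the direction over a star-shaped domain. -/
lemma setLIntegral_direction [Nontrivial E] {f : E → ENNReal} (hf : Measurable f) {s : E → ℝ}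
    (hs : Measurable s) (hpos : ∀ u : E, ‖u‖ = 1 → 0 < s u) :
    ∫⁻ w, {w : E | s (‖w‖⁻¹ • w) * ‖w‖ < 1}.indicator (fun w => f (‖w‖⁻¹ • w)) w =
      ENNReal.ofReal (Module.finrank ℝ E : ℝ)⁻¹ *
        ∫⁻ u, ENNReal.ofReal (s u ^ Module.finrank ℝ E)⁻¹ * f u ∂(sphereMeasure E) := by
  have hd : 0 < Module.finrank ℝ E := Module.finrank_pos
  have hN : Measurable fun w : E => ‖w‖⁻¹ • w := measurable_norm.inv.smul measurable_id
  have hset : MeasurableSet {w : E | s (‖w‖⁻¹ • w) * ‖w‖ < 1} :=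
    measurableSet_lt ((hs.comp hN).mul measurable_norm) measurable_const
  have hfN : Measurable fun w : E => f (‖w‖⁻¹ • w) := hf.comp hN
  rw [lintegral_polar (hfN.indicator hset), ← lintegral_const_mul _ (by fun_prop)]
  refine lintegral_congr_ae ?_
  filter_upwards [ae_norm_eq_one_sphereMeasure E] with u hu
  have hsu := hpos u hu
  -- On the ray through `u`, the domain is the interval `(0, 1 / s u)`.
  have h1 : ∀ r : Set.Ioi (0 : ℝ),
      {w : E | s (‖w‖⁻¹ • w) * ‖w‖ < 1}.indicator (fun w => f (‖w‖⁻¹ • w)) ((r : ℝ) • u) =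
        (Set.Iio (⟨(s u)⁻¹, inv_pos.2 hsu⟩ : Set.Ioi (0 : ℝ))).indicator (fun _ => f u) r := by
    intro r
    have hr : (0 : ℝ) < r := r.2
    have hrn : ‖(r : ℝ) • u‖ = r := by rw [norm_smul, hu, mul_one, Real.norm_of_nonneg hr.le]
    have : (r : ℝ) • u ∈ {w : E | s (‖w‖⁻¹ • w) * ‖w‖ < 1} ↔
        r ∈ Set.Iio (⟨(s u)⁻¹, inv_pos.2 hsu⟩ : Set.Ioi (0 : ℝ)) := by
      rw [Set.mem_ofPred_eq, norm_inv_smul_smul hr hu, hrn, Set.mem_Iio, ← Subtype.coe_lt_coe,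
        lt_inv_comm₀ hr hsu, ← one_div, lt_div_iff₀ hr]
    by_cases h : (r : ℝ) • u ∈ {w : E | s (‖w‖⁻¹ • w) * ‖w‖ < 1}
    · rw [Set.indicator_of_mem h, Set.indicator_of_mem (this.1 h), norm_inv_smul_smul hr hu]
    · rw [Set.indicator_of_notMem h, Set.indicator_of_notMem (fun h' => h (this.2 h'))]
  -- The radial integral of `r ^ (d - 1)` up to `1 / s u` is `(s u)⁻ᵈ / d`.
  rw [lintegral_congr h1, lintegral_indicator_const measurableSet_Iio,
    Measure.volumeIoiPow_apply_Iio, Nat.sub_add_cancel hd, Nat.cast_pred hd, sub_add_cancel,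
    ← mul_assoc, ← ENNReal.ofReal_mul (by positivity), mul_comm, inv_pow]
  congr 2
  rw [div_eq_mul_inv, mul_comm]

/-- The surface measure is invariant under the antipodal map. -/
lemma lintegral_sphereMeasure_neg [Nontrivial E] {f : E → ENNReal} (hf : Measurable f) :
    ∫⁻ u, f (-u) ∂(sphereMeasure E) = ∫⁻ u, f u ∂(sphereMeasure E) := by
  have key : ∀ g : E → ENNReal, Measurable g →
      ∫⁻ w, {w : E | ‖w‖ < 1}.indicator (fun w => g (‖w‖⁻¹ • w)) w =
      ENNReal.ofReal (Module.finrank ℝ E : ℝ)⁻¹ * ∫⁻ u, g u ∂(sphereMeasure E) := fun g hg => by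
    simpa using setLIntegral_direction hg (s := fun _ => 1) measurable_const (fun _ _ => one_pos)
  have h := key _ (hf.comp measurable_neg)
  -- Lebesgue measure and the unit ball are both invariant under negation.
  rw [← lintegral_neg_eq_self] at h
  simp only [Set.indicator, Set.mem_ofPred_eq, norm_neg, Function.comp_apply, smul_neg,
    neg_neg] at h
  have h' := key f hf
  simp only [Set.indicator, Set.mem_ofPred_eq] at h'
  rw [h'] at h
  exact ((ENNReal.mul_right_inj (by simpa using (Module.finrank_pos (R := ℝ) (M := E)).ne') ENNReal.ofReal_ne_top).1 h).symm

end Sphere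

/-! ### Lorentz boosts and their Jacobian on the sphere. -/

section Boost

variable {E : Type*} [NormedAddCommGroup E] [InnerProductSpace ℝ E]

/-- The action on `w` of the Lorentz boost with rapidity `t` in the direction `e`, applied to the
point `(‖w‖, w)` of the light cone. -/
def boost (e : E) (t : ℝ) (w : E) : E :=
  w + (Real.sinh t * ‖w‖ + inner ℝ e w * (Real.cosh t - 1)) • e

/-- The factor by which a boost stretches the vector `w`, times the norm of `w`. -/
def boostNorm (e : E) (t : ℝ) (w : E) : ℝ := Real.cosh t * ‖w‖ + inner ℝ e w * Real.sinh t

lemma inner_boost {e : E} (he : ‖e‖ = 1) (t : ℝ) (w : E) :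
    inner ℝ e (boost e t w) = Real.cosh t * inner ℝ e w + Real.sinh t * ‖w‖ := by
  rw [boost, inner_add_right, real_inner_smul_right, real_inner_self_eq_norm_sq, he]
  ring

/-- Cauchy–Schwarz together with `|sinh t| < cosh t`: a boost keeps the time component of a nonzero
point of the forward light cone positive. -/
lemma boostNorm_pos {e : E} (he : ‖e‖ = 1) (t : ℝ) {w : E} (hw : w ≠ 0) :
    0 < boostNorm e t w := by
  have h1 : |inner ℝ e w| ≤ ‖w‖ := by simpa [he] using abs_real_inner_le_norm e w
  have h2 : |Real.sinh t| < Real.cosh t := by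
    rw [← Real.cosh_abs, Real.abs_sinh]
    exact Real.sinh_lt_cosh _
  have h3 : |inner ℝ e w * Real.sinh t| < Real.cosh t * ‖w‖ := by
    rw [abs_mul, mul_comm]
    exact mul_lt_mul_of_lt_of_le_of_nonneg_of_pos h2 h1 (abs_nonneg _) (norm_pos_iff.2 hw)
  have := (abs_lt.1 h3).1
  unfold boostNorm
  linarith

/-- `boostNorm` and `boost` are the time and space components of the boosted null vector `(‖w‖, w)`,
which stays on the light cone because `cosh² - sinh² = 1`. -/
lemma norm_boost {e : E} (he : ‖e‖ = 1) (t : ℝ) (w : E) :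
    ‖boost e t w‖ = boostNorm e t w := by
  rcases eq_or_ne w 0 with rfl | hw
  · simp [boost, boostNorm]
  have hsq : ‖boost e t w‖ ^ 2 = boostNorm e t w ^ 2 := by
    rw [boost, norm_add_sq_real, norm_smul, he, real_inner_smul_right, real_inner_comm e w,
      Real.norm_eq_abs, mul_one, sq_abs, boostNorm]
    linear_combination (‖w‖ ^ 2 + inner ℝ e w ^ 2 * (-1)) * (-1) * Real.cosh_sq_sub_sinh_sq t
  exact (sq_eq_sq₀ (norm_nonneg _) (boostNorm_pos he t hw).le).1 hsq

lemma boost_neg_boost {e : E} (he : ‖e‖ = 1) (t : ℝ) (w : E) :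
    boost e (-t) (boost e t w) = w := by
  rw [boost, norm_boost he, inner_boost he, boost, add_assoc, ← add_smul, Real.sinh_neg,
    Real.cosh_neg]
  convert add_zero w
  convert zero_smul ℝ e
  rw [boostNorm]
  linear_combination inner ℝ e w * Real.cosh_sq_sub_sinh_sq t

lemma boost_ne_zero {e : E} (he : ‖e‖ = 1) (t : ℝ) {w : E} (hw : w ≠ 0) : boost e t w ≠ 0 := by
  rw [← norm_pos_iff, norm_boost he]
  exact boostNorm_pos he t hw

lemma boost_image {e : E} (he : ‖e‖ = 1) (t : ℝ) : boost e t '' {0}ᶜ = {0}ᶜ := by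
  ext w
  refine ⟨?_, fun hw => ⟨boost e (-t) w, boost_ne_zero he _ hw, ?_⟩⟩
  · rintro ⟨v, hv, rfl⟩
    exact boost_ne_zero he t hv
  · simpa using boost_neg_boost he (-t) w

lemma boost_injective {e : E} (he : ‖e‖ = 1) (t : ℝ) : Function.Injective (boost e t) :=
  Function.LeftInverse.injective (boost_neg_boost he t)

lemma boost_smul {r : ℝ} (hr : 0 ≤ r) (e : E) (t : ℝ) (w : E) :
    boost e t (r • w) = r • boost e t w := by
  simp only [boost, norm_smul, Real.norm_of_nonneg hr, real_inner_smul_right, smul_add, smul_smul]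
  congr 2
  ring

lemma boostNorm_smul {r : ℝ} (hr : 0 ≤ r) (e : E) (t : ℝ) (w : E) :
    boostNorm e t (r • w) = r * boostNorm e t w := by
  simp only [boostNorm, norm_smul, Real.norm_of_nonneg hr, real_inner_smul_right]
  ring

/-- The derivative of a boost of the light cone. -/
def boostFDeriv (e : E) (t : ℝ) (w : E) : E →L[ℝ] E :=
  ContinuousLinearMap.id ℝ E + ((Real.sinh t * ‖w‖⁻¹) • innerSL ℝ w +
    (Real.cosh t - 1) • innerSL ℝ e).smulRight e

lemma hasFDerivAt_boost (e : E) (t : ℝ) {w : E} (hw : w ≠ 0) :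
    HasFDerivAt (boost e t) (boostFDeriv e t w) w := by
  have h1 : HasFDerivAt (fun w : E => ‖w‖) (‖w‖⁻¹ • innerSL ℝ w) w := by
    have h := (hasStrictFDerivAt_norm_sq w).hasFDerivAt.sqrt (by simpa using hw)
    simp only [Real.sqrt_sq (norm_nonneg _)] at h
    convert h using 1
    ext v
    simp
    field_simp
  have h2 : HasFDerivAt (fun w : E => inner ℝ e w) (innerSL ℝ e) w := (innerSL ℝ e).hasFDerivAt
  have h3 : HasFDerivAt (boost e t) _ w := (hasFDerivAt_id (𝕜 := ℝ) w).add
    (((h1.const_mul (Real.sinh t)).add (h2.mul_const (Real.cosh t - 1))).smul_const e)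
  convert h3 using 1
  rw [boostFDeriv, smul_smul]

/-- The derivative is the identity plus a rank-one map `φ(·) e`, so its determinant is `1 + φ(e)`.
-/
lemma det_boostFDeriv [FiniteDimensional ℝ E] {e : E} (he : ‖e‖ = 1) (t : ℝ) {w : E}
    (hw : w ≠ 0) : (boostFDeriv e t w).det = boostNorm e t (‖w‖⁻¹ • w) := by
  have h := LinearMap.transvection.det
    (((Real.sinh t * ‖w‖⁻¹) • innerSL ℝ w + (Real.cosh t - 1) • innerSL ℝ e : E →L[ℝ] ℝ) :
      Module.Dual ℝ E) e
  have h2 : ((boostFDeriv e t w : E →L[ℝ] E) : E →ₗ[ℝ] E) = LinearMap.transvection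
      (((Real.sinh t * ‖w‖⁻¹) • innerSL ℝ w + (Real.cosh t - 1) • innerSL ℝ e : E →L[ℝ] ℝ) :
      Module.Dual ℝ E) e := by
    ext v
    simp [boostFDeriv, LinearMap.transvection.apply]
  rw [ContinuousLinearMap.det, h2, h, boostNorm_smul (by positivity), boostNorm]
  have : ‖w‖ ≠ 0 := norm_ne_zero_iff.2 hw
  simp [he, real_inner_comm]
  field_simp
  ring

/-- The action of a boost on the directions of the light cone. -/
def boostDir (e : E) (t : ℝ) (u : E) : E := (boostNorm e t u)⁻¹ • boost e t u

lemma norm_boostDir {e : E} (he : ‖e‖ = 1) (t : ℝ) {u : E} (hu : u ≠ 0) :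
    ‖boostDir e t u‖ = 1 := by
  rw [boostDir, norm_smul, norm_boost he, norm_inv, Real.norm_of_nonneg (boostNorm_pos he t hu).le,
    inv_mul_cancel₀ (boostNorm_pos he t hu).ne']

lemma neg_boost (e : E) (t : ℝ) (u : E) : boost e t (-u) = -boost e (-t) u := by
  simp only [boost, norm_neg, inner_neg_right, Real.sinh_neg, Real.cosh_neg, neg_add, ← neg_smul]
  congr 2
  ring

lemma neg_boostNorm (e : E) (t : ℝ) (u : E) : boostNorm e t (-u) = boostNorm e (-t) u := by
  simp [boostNorm]

/-- Reversing the velocity turns the boost into its inverse; homogeneity then leaves only the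
earlier normalization. This makes the second kinetic energy change cancel the first. -/
lemma boostNorm_neg_boostDir {e : E} (he : ‖e‖ = 1) (t : ℝ) {u : E} (hu : ‖u‖ = 1) :
    boostNorm e t (-boostDir e t u) = (boostNorm e t u)⁻¹ := by
  have hu0 : u ≠ 0 := by rintro rfl; simp at hu
  rw [neg_boostNorm, boostDir, boostNorm_smul (inv_nonneg.2 (boostNorm_pos he t hu0).le),
    ← norm_boost he (-t), boost_neg_boost he, hu, mul_one]

lemma boostDir_neg_boostDir {e : E} (he : ‖e‖ = 1) (t : ℝ) {u : E} (hu : ‖u‖ = 1) :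
    boostDir e t (-boostDir e t u) = -u := by
  have hu0 : u ≠ 0 := by rintro rfl; simp at hu
  have hp := boostNorm_pos he t hu0
  rw [boostDir, boostNorm_neg_boostDir he t hu, neg_boost, boostDir, boost_smul (inv_nonneg.2 hp.le),
    boost_neg_boost he, inv_inv, smul_neg, smul_smul, mul_inv_cancel₀ hp.ne', one_smul]

lemma boostDir_smul {r : ℝ} (hr : 0 < r) (e : E) (t : ℝ) (w : E) :
    boostDir e t (r • w) = boostDir e t w := by
  rw [boostDir, boostNorm_smul hr.le, boost_smul hr.le, smul_smul, mul_inv_rev, mul_assoc,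
    inv_mul_cancel₀ hr.ne', mul_one, boostDir]

variable [FiniteDimensional ℝ E] [MeasurableSpace E] [BorelSpace E]

/-- The Jacobian of the action of a boost on the unit sphere. -/
lemma lintegral_boostDir [Nontrivial E] {e : E} (he : ‖e‖ = 1) (t : ℝ) {f : E → ENNReal}
    (hf : Measurable f) :
    ∫⁻ u, ENNReal.ofReal (boostNorm e t u ^ (Module.finrank ℝ E - 1))⁻¹ * f (boostDir e t u)
      ∂(sphereMeasure E) = ∫⁻ u, f u ∂(sphereMeasure E) := by
  have hd : 0 < Module.finrank ℝ E := Module.finrank_pos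
  have hbn : Measurable (boostNorm e t) := by unfold boostNorm; fun_prop
  have hb : Measurable (boost e t) := by unfold boost; fun_prop
  have hbd : Measurable (boostDir e t) := hbn.inv.smul hb
  have hpos : ∀ u : E, ‖u‖ = 1 → 0 < boostNorm e t u := fun u hu =>
    boostNorm_pos he t (by rintro rfl; simp at hu)
  have h1 := setLIntegral_direction hf (s := fun _ => 1) measurable_const (fun _ _ => one_pos)
  have h2 := setLIntegral_direction (f := fun u => ENNReal.ofReal (boostNorm e t u) *
    f (boostDir e t u)) (by fun_prop) hbn hpos
  simp only [one_mul, one_pow, inv_one, ENNReal.ofReal_one] at h1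
  -- Change variables by the boost in the integral of `f (w / ‖w‖)` over the unit ball. The boost is
  -- a bijection of the punctured space, on which it is differentiable.
  have h3 := lintegral_image_eq_lintegral_abs_det_fderiv_mul (volume : Measure E)
    (measurableSet_singleton (0 : E)).compl
    (fun w hw => (hasFDerivAt_boost e t hw).hasFDerivWithinAt) (boost_injective he t).injOn
    ({w : E | ‖w‖ < 1}.indicator (fun w => f (‖w‖⁻¹ • w)))
  rw [boost_image he] at h3
  -- The preimage of the ball is the star-shaped domain with `s = boostNorm e t`. Its radial
  -- integral gives the power `-d`, and the determinant restores one factor, leaving `-(d - 1)`.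
  have h4 : ∀ w ∈ ({0}ᶜ : Set E), ENNReal.ofReal |(boostFDeriv e t w).det| *
      {w : E | ‖w‖ < 1}.indicator (fun w => f (‖w‖⁻¹ • w)) (boost e t w) =
      {w : E | boostNorm e t (‖w‖⁻¹ • w) * ‖w‖ < 1}.indicator (fun w =>
        ENNReal.ofReal (boostNorm e t (‖w‖⁻¹ • w)) * f (boostDir e t (‖w‖⁻¹ • w))) w := by
    intro w hw
    have hw' : 0 < ‖w‖ := norm_pos_iff.2 hw
    have hi : 0 < ‖w‖⁻¹ := inv_pos.2 hw'
    have hmem : boost e t w ∈ {w : E | ‖w‖ < 1} ↔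
        w ∈ {w : E | boostNorm e t (‖w‖⁻¹ • w) * ‖w‖ < 1} := by
      simp only [Set.mem_ofPred_eq]
      rw [norm_boost he, boostNorm_smul hi.le, mul_right_comm, inv_mul_cancel₀ hw'.ne', one_mul]
    rw [det_boostFDeriv he t hw, abs_of_pos (by
      rw [boostNorm_smul hi.le]; exact mul_pos hi (boostNorm_pos he t hw))]
    by_cases h : boost e t w ∈ {w : E | ‖w‖ < 1}
    · rw [Set.indicator_of_mem h, Set.indicator_of_mem (hmem.1 h), boostDir_smul hi, boostDir,
        norm_boost he]
    · rw [Set.indicator_of_notMem h, Set.indicator_of_notMem (fun h' => h (hmem.2 h')), mul_zero]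
  rw [setLIntegral_congr_fun (measurableSet_singleton (0 : E)).compl h4, restrict_compl_singleton,
    h1, h2] at h3
  have h5 := (ENNReal.mul_right_inj (by simpa using hd.ne') ENNReal.ofReal_ne_top).1 h3
  rw [h5]
  refine lintegral_congr_ae ?_
  filter_upwards [ae_norm_eq_one_sphereMeasure E] with u hu
  have hp := hpos u hu
  rw [← mul_assoc, ← ENNReal.ofReal_mul (by positivity)]
  congr 2
  obtain ⟨k, hk⟩ := Nat.exists_eq_succ_of_ne_zero hd.ne'
  rw [hk, Nat.succ_eq_add_one, Nat.add_sub_cancel, pow_succ]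
  field_simp

end Boost

/-! ### Direction of a shifted normal vector. -/

section Gaussian

variable {E : Type*} [NormedAddCommGroup E] [InnerProductSpace ℝ E] [FiniteDimensional ℝ E]
  [MeasurableSpace E] [BorelSpace E]

variable (E) in
/-- The normalizing constant of the standard normal density. -/
def gaussianConst : ℝ := ((Real.pi / (1 / 2)) ^ ((Module.finrank ℝ E : ℝ) / 2))⁻¹

omit [FiniteDimensional ℝ E] [MeasurableSpace E] [BorelSpace E] in
lemma gaussianConst_pos : 0 < gaussianConst E := by
  unfold gaussianConst; positivity

/-- The standard normal distribution has density proportional to `exp (-‖x‖² / 2)`. -/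
lemma stdGaussian_eq_withDensity : stdGaussian E = (volume : Measure E).withDensity
    fun x => ENNReal.ofReal (gaussianConst E * Real.exp (-(1 / 2) * ‖x‖ ^ 2)) := by
  have hb : 0 < ((1 / 2 : ℂ)).re := by norm_num
  have hint : Integrable fun x : E => gaussianConst E * Real.exp (-(1 / 2) * ‖x‖ ^ 2) := by
    refine Integrable.const_mul ?_ _
    have h := (GaussianFourier.integrable_cexp_neg_mul_sq_norm_add (V := E) hb 0 0).norm
    refine h.congr (Filter.Eventually.of_forall fun x => ?_)
    simp only [Complex.norm_exp]
    congr 1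
    simp [← Complex.ofReal_pow]
  have := isFiniteMeasure_withDensity_ofReal hint.hasFiniteIntegral
  -- Both measures are finite, so it suffices to compare characteristic functions; that of the
  -- density is a Gaussian Fourier integral.
  refine Measure.ext_of_charFun ?_
  ext t
  rw [charFun_stdGaussian, charFun_apply, integral_withDensity_eq_integral_toReal_smul
    (by fun_prop) (by simp)]
  have h1 : ∀ x : E, (ENNReal.ofReal (gaussianConst E * Real.exp (-(1 / 2) * ‖x‖ ^ 2))).toReal •
      Complex.exp ((inner ℝ x t : ℝ) * Complex.I) = (gaussianConst E : ℂ) *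
        Complex.exp (-(1 / 2) * (‖x‖ : ℂ) ^ 2 + Complex.I * (inner ℝ t x : ℝ)) := by
    intro x
    rw [ENNReal.toReal_ofReal (mul_nonneg gaussianConst_pos.le (Real.exp_nonneg _)),
      Complex.real_smul, real_inner_comm, Complex.exp_add, mul_comm Complex.I]
    push_cast
    ring
  have h2 : ((Real.pi : ℂ) / (1 / 2)) ^ ((Module.finrank ℝ E : ℂ) / 2) =
      ((gaussianConst E)⁻¹ : ℝ) := by
    rw [gaussianConst, inv_inv, Complex.ofReal_cpow (by positivity)]
    push_cast
    rfl
  simp_rw [h1]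
  rw [integral_const_mul, GaussianFourier.integral_cexp_neg_mul_sq_norm_add hb, h2, ← mul_assoc,
    ← Complex.ofReal_mul, mul_inv_cancel₀ gaussianConst_pos.ne', Complex.I_sq]
  simp only [Complex.ofReal_one, one_mul]
  congr 1
  ring

/-- The direction of a normal vector with mean `c • u` and covariance `a² I`, where `u` is a unit
vector, has a density with respect to the surface measure, which depends only on the inner product
with `u`. -/
lemma exists_density_direction [Nontrivial E] (c : ℝ) {a : ℝ} (ha : a ≠ 0) :
    ∃ k : ℝ → ENNReal, Measurable k ∧ ∀ u : E, ‖u‖ = 1 → ∀ h : E → ENNReal, Measurable h →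
      ∫⁻ g, h (‖c • u + a • g‖⁻¹ • (c • u + a • g)) ∂(stdGaussian E) =
        ∫⁻ w, k (inner ℝ u w) * h w ∂(sphereMeasure E) := by
  -- The Jacobian of the substitution `w = c • u + a • g`.
  set K : ENNReal := ENNReal.ofReal |(a ^ Module.finrank ℝ E)⁻¹|
  have hjoint : Measurable fun q : ℝ × Set.Ioi (0 : ℝ) => ENNReal.ofReal (gaussianConst E *
      Real.exp (-(1 / 2) * ((a⁻¹) ^ 2 * ((q.2 : ℝ) ^ 2 - 2 * q.2 * c * q.1 + c ^ 2)))) := by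
    fun_prop
  refine ⟨fun s => K * ∫⁻ r, ENNReal.ofReal (gaussianConst E *
      Real.exp (-(1 / 2) * ((a⁻¹) ^ 2 * ((r : ℝ) ^ 2 - 2 * r * c * s + c ^ 2))))
      ∂(Measure.volumeIoiPow (Module.finrank ℝ E - 1)),
    hjoint.lintegral_prod_right'.const_mul _, fun u hu h hh => ?_⟩
  have hF : Measurable fun w : E => h (‖w‖⁻¹ • w) :=
    hh.comp (measurable_norm.inv.smul measurable_id)
  -- The normal density at `g = a⁻¹ • (w - c • u)`, times the test function of the direction of `w`.
  set P : E → ENNReal := fun w => ENNReal.ofReal (gaussianConst E *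
    Real.exp (-(1 / 2) * ‖a⁻¹ • (w - c • u)‖ ^ 2)) * h (‖w‖⁻¹ • w) with hP
  have hPm : Measurable P := by
    refine Measurable.mul ?_ hF
    fun_prop
  calc ∫⁻ g, h (‖c • u + a • g‖⁻¹ • (c • u + a • g)) ∂(stdGaussian E)
      = ∫⁻ g, P (c • u + a • g) := by
        have hFg : Measurable fun g : E => h (‖c • u + a • g‖⁻¹ • (c • u + a • g)) :=
          hF.comp (by fun_prop : Measurable fun g : E => c • u + a • g)
        rw [stdGaussian_eq_withDensity, lintegral_withDensity_eq_lintegral_mul _ (by fun_prop) hFg]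
        refine lintegral_congr fun g => ?_
        simp only [hP, Pi.mul_apply, add_sub_cancel_left, smul_smul,
          inv_mul_cancel₀ ha, one_smul]
    _ = K * ∫⁻ w, P w := by
        rw [← lintegral_add_left_eq_self P (c • u), ← smul_eq_mul K, ← lintegral_smul_measure,
          ← Measure.map_addHaar_smul volume ha, lintegral_map (by fun_prop) (by fun_prop)]
    _ = _ := by
        -- For unit vectors, `‖r w - c u‖² = r² - 2 r c ⟨u, w⟩ + c²`; integrating out `r` leaves a
        -- function of `⟨u, w⟩`.
        rw [lintegral_polar hPm, ← lintegral_const_mul _ (by fun_prop)]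
        refine lintegral_congr_ae ?_
        filter_upwards [ae_norm_eq_one_sphereMeasure E] with w hw
        rw [mul_assoc, ← lintegral_mul_const _ (by fun_prop)]
        congr 1
        refine lintegral_congr fun r => ?_
        have hr : (0 : ℝ) < r := r.2
        simp only [hP]
        rw [norm_inv_smul_smul hr hw, norm_smul, mul_pow, norm_sub_sq_real, norm_smul, norm_smul,
          hw, hu, real_inner_smul_left, real_inner_smul_right, real_inner_comm]
        simp only [Real.norm_eq_abs, mul_one, sq_abs]
        congr 4
        ring

end Gaussian

/-! ### Adjointness up to an involution. -/

section SkewAdjoint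

variable {X : Type*} [MeasurableSpace X]

/-- Operators on functions that are adjoint to each other up to the involution `J`. -/
def SkewAdjoint (ν : Measure X) (J : X → X) (T T' : (X → ENNReal) → X → ENNReal) : Prop :=
  ∀ F G : X → ENNReal, Measurable F → Measurable G →
    ∫⁻ x, F x * T G x ∂ν = ∫⁻ x, G (J x) * T' (F ∘ J) x ∂ν

/-- The operator maps measurable functions to measurable functions. -/
def PreservesMeasurable (T : (X → ENNReal) → X → ENNReal) : Prop :=
  ∀ G : X → ENNReal, Measurable G → Measurable (T G)

/-- The relation says that the adjoint of `T` is `J T' J`. Adjoints reverse products, and the two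
inner copies of `J` cancel. -/
lemma SkewAdjoint.comp {ν : Measure X} {J : X → X} (hJ : MeasurePreserving J ν ν)
    (hJJ : Function.Involutive J) {T T' S S' : (X → ENNReal) → X → ENNReal}
    (hT' : PreservesMeasurable T') (hS : PreservesMeasurable S)
    (h : SkewAdjoint ν J T T') (h' : SkewAdjoint ν J S S') :
    SkewAdjoint ν J (T ∘ S) (S' ∘ T') := by
  intro F G hF hG
  have hFJ : Measurable (T' (F ∘ J)) := hT' _ (hF.comp hJ.measurable)
  have h1 := hJ.lintegral_comp (f := fun x => S G x * T' (F ∘ J) (J x))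
    ((hS G hG).mul (hFJ.comp hJ.measurable))
  simp only [hJJ _] at h1
  have h2 := h' (T' (F ∘ J) ∘ J) G (hFJ.comp hJ.measurable) hG
  have h3 : (T' (F ∘ J) ∘ J) ∘ J = T' (F ∘ J) := by
    ext x; simp [hJJ x]
  rw [h3] at h2
  simp only [Function.comp_apply]
  rw [h F (S G) hF (hS G hG), h1, ← h2]
  exact lintegral_congr fun x => mul_comm _ _

lemma PreservesMeasurable.comp {T S : (X → ENNReal) → X → ENNReal}
    (hT : PreservesMeasurable T) (hS : PreservesMeasurable S) : PreservesMeasurable (T ∘ S) :=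
  fun G hG => hT _ (hS G hG)

lemma PreservesMeasurable.iterate {T : (X → ENNReal) → X → ENNReal}
    (hT : PreservesMeasurable T) (n : ℕ) : PreservesMeasurable T^[n] := by
  induction n with
  | zero => exact fun G hG => hG
  | succ n ih => rw [Function.iterate_succ]; exact ih.comp hT

/-- Reversing the order does not affect powers of a single operator; for `n = 0` this is the
invariance of `ν` under `J`. -/
lemma SkewAdjoint.iterate {ν : Measure X} {J : X → X} (hJ : MeasurePreserving J ν ν)
    (hJJ : Function.Involutive J) {T : (X → ENNReal) → X → ENNReal}
    (hT : PreservesMeasurable T) (h : SkewAdjoint ν J T T) (n : ℕ) :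
    SkewAdjoint ν J T^[n] T^[n] := by
  induction n with
  | zero =>
    intro F G hF hG
    have h1 := hJ.lintegral_comp (f := fun x => F x * G x) (hF.mul hG)
    simp only [Function.iterate_zero, id_eq, Function.comp_apply]
    rw [← h1]
    exact lintegral_congr fun x => mul_comm _ _
  | succ n ih =>
    have h1 := ih.comp hJ hJJ (hT.iterate n) hT h
    rwa [← Function.iterate_succ, ← Function.iterate_succ'] at h1

/-- Composition with a measure-preserving map that is reversed by `J`. -/
lemma skewAdjoint_comp_right {ν : Measure X} {J M : X → X} (hJ : MeasurePreserving J ν ν)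
    (hM : MeasurePreserving M ν ν)
    (hMJ : ∀ᵐ x ∂ν, M (J (M x)) = J x) :
    SkewAdjoint ν J (fun G => G ∘ M) (fun G => G ∘ M) := by
  intro F G hF hG
  -- Substitute `J x` for `x`, then `M x` for `x`, and simplify with `M J M = J`.
  have h1 := hJ.lintegral_comp (f := fun x => F x * G (M x)) (hF.mul (hG.comp hM.measurable))
  have h2 := hM.lintegral_comp (f := fun x => F (J x) * G (M (J x)))
    ((hF.comp hJ.measurable).mul (hG.comp (hM.measurable.comp hJ.measurable)))
  simp only [Function.comp_apply]
  rw [← h1, ← h2]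
  refine lintegral_congr_ae ?_
  filter_upwards [hMJ] with x hx
  rw [hx, mul_comm]

end SkewAdjoint

/-! ### The extended phase space and its invariant measure. -/

section ExtendedSpace

variable {d : ℕ}

lemma uniformSphere_eq (d : ℕ) : uniformSphere d =
    ((volume : Measure (Pos d)).toSphere Set.univ)⁻¹ • sphereMeasure (Pos d) := by
  rw [uniformSphere, sphereMeasure, Measure.map_smul]

lemma nontrivial_pos (hd : 2 ≤ d) : Nontrivial (Pos d) := by
  have : Nonempty (Fin d) := ⟨⟨0, by omega⟩⟩
  infer_instance

lemma isProbabilityMeasure_uniformSphere (hd : 2 ≤ d) :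
    IsProbabilityMeasure (uniformSphere d) := by
  have := nontrivial_pos hd
  refine ⟨?_⟩
  rw [uniformSphere_eq, Measure.smul_apply, sphereMeasure,
    Measure.map_apply measurable_subtype_coe .univ, Set.preimage_univ, smul_eq_mul]
  exact ENNReal.inv_mul_cancel (by simp [-Measure.toSphere_apply_univ]) (measure_ne_top _ _)

instance : SFinite (uniformSphere d) := by
  rw [uniformSphere_eq]; infer_instance

lemma ae_norm_eq_one_uniformSphere (d : ℕ) : ∀ᵐ u ∂uniformSphere d, ‖u‖ = 1 := by
  rw [uniformSphere_eq]
  exact Measure.ae_smul_measure (ae_norm_eq_one_sphereMeasure _) _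

lemma lintegral_uniformSphere_neg (hd : 2 ≤ d) {f : Pos d → ENNReal} (hf : Measurable f) :
    ∫⁻ u, f (-u) ∂uniformSphere d = ∫⁻ u, f u ∂uniformSphere d := by
  have := nontrivial_pos hd
  rw [uniformSphere_eq, lintegral_smul_measure, lintegral_smul_measure,
    lintegral_sphereMeasure_neg hf]

instance (L : Pos d → ℝ) : SFinite (target L) := by
  unfold target; infer_instance

/-- The measure on phase space, extended by a real coordinate on which the exponential of the
energy error acts by multiplication, which is preserved by the algorithm. -/
def extMeasure (L : Pos d → ℝ) : Measure (Phase d × ℝ) :=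
  ((target L).prod (uniformSphere d)).prod volume

instance (L : Pos d → ℝ) : SFinite (extMeasure L) := by
  unfold extMeasure; infer_instance

/-- Reversal of the velocity. -/
def flip (y : Phase d × ℝ) : Phase d × ℝ := ((y.1.1, -y.1.2), y.2)

lemma flip_involutive : Function.Involutive (flip (d := d)) := fun y => by simp [flip]

lemma lintegral_extMeasure (L : Pos d → ℝ) {F : Phase d × ℝ → ENNReal} (hF : Measurable F) :
    ∫⁻ y, F y ∂extMeasure L = ∫⁻ x, ∫⁻ u, ∫⁻ v, F ((x, u), v) ∂volume ∂uniformSphere d ∂target L := by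
  rw [extMeasure, lintegral_prod _ hF.aemeasurable, lintegral_prod]
  exact hF.lintegral_prod_right'.aemeasurable

/-- This order suits the position update, which fixes the velocity. -/
lemma lintegral_extMeasure_vel (L : Pos d → ℝ) {F : Phase d × ℝ → ENNReal} (hF : Measurable F) :
    ∫⁻ y, F y ∂extMeasure L = ∫⁻ u, ∫⁻ x, ∫⁻ v, F ((x, u), v) ∂volume ∂target L ∂uniformSphere d := by
  rw [lintegral_extMeasure L hF, lintegral_lintegral_swap]
  exact hF.lintegral_prod_right'.aemeasurable

/-- This order suits the refreshment, which fixes `x` and `v`. -/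
lemma lintegral_extMeasure_weight (L : Pos d → ℝ) {F : Phase d × ℝ → ENNReal}
    (hF : Measurable F) :
    ∫⁻ y, F y ∂extMeasure L = ∫⁻ x, ∫⁻ v, ∫⁻ u, F ((x, u), v) ∂uniformSphere d ∂volume ∂target L := by
  rw [lintegral_extMeasure L hF]
  refine lintegral_congr fun x => ?_
  rw [lintegral_lintegral_swap]
  refine Measurable.aemeasurable ?_
  fun_prop

lemma ae_extMeasure_norm (L : Pos d → ℝ) : ∀ᵐ y ∂extMeasure L, ‖y.1.2‖ = 1 := by
  have h1 : ∀ᵐ z ∂(target L).prod (uniformSphere d), ‖z.2‖ = 1 :=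
    Measure.quasiMeasurePreserving_snd.ae (ae_norm_eq_one_uniformSphere d)
  exact Measure.quasiMeasurePreserving_fst.ae h1

lemma measurePreserving_of_lintegral {X : Type*} [MeasurableSpace X] {ν : Measure X} {M : X → X}
    (hM : Measurable M) (h : ∀ G : X → ENNReal, Measurable G → ∫⁻ x, G (M x) ∂ν = ∫⁻ x, G x ∂ν) :
    MeasurePreserving M ν ν := by
  refine ⟨hM, Measure.ext_of_lintegral _ fun G hG => ?_⟩
  rw [lintegral_map hG hM, h G hG]

lemma measurable_flip : Measurable (flip (d := d)) := by unfold flip; fun_prop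

lemma measurePreserving_flip (hd : 2 ≤ d) (L : Pos d → ℝ) :
    MeasurePreserving flip (extMeasure L) (extMeasure L) := by
  refine measurePreserving_of_lintegral measurable_flip fun G hG => ?_
  rw [lintegral_extMeasure L (F := fun y => G (flip y)) (hG.comp measurable_flip), lintegral_extMeasure L hG]
  refine lintegral_congr fun x => ?_
  exact lintegral_uniformSphere_neg hd (f := fun u => ∫⁻ v, G ((x, u), v)) (by fun_prop)

lemma lintegral_mul_exp {G : ℝ → ENNReal} (hG : Measurable G) (t : ℝ) :
    ∫⁻ v, G (v * Real.exp t) = ENNReal.ofReal (Real.exp (-t)) * ∫⁻ v, G v := by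
  have h := lintegral_map (μ := (volume : Measure ℝ)) hG (measurable_mul_const (Real.exp t))
  rw [← h, Real.map_volume_mul_right (Real.exp_ne_zero t), lintegral_smul_measure, smul_eq_mul,
    Real.exp_neg, abs_of_pos (inv_pos.2 (Real.exp_pos t))]

/-! ### Invariance and reversibility of the deterministic updates. -/

/-- The position update on the extended phase space. -/
def extA (L : Pos d → ℝ) (ε : ℝ) (y : Phase d × ℝ) : Phase d × ℝ :=
  (updateA ε y.1, y.2 * Real.exp (deltaV L ε y.1))

/-- The velocity update on the extended phase space. -/
def extB (L : Pos d → ℝ) (ε : ℝ) (y : Phase d × ℝ) : Phase d × ℝ :=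
  (updateB L ε y.1, y.2 * Real.exp (deltaK L ε y.1))

lemma measurable_updateA (ε : ℝ) : Measurable (updateA (d := d) ε) := by
  unfold updateA; fun_prop

lemma measurable_deltaV {L : Pos d → ℝ} (hL : Measurable L) (ε : ℝ) : Measurable (deltaV L ε) := by
  unfold deltaV updateA; fun_prop

lemma measurable_gradient (L : Pos d → ℝ) : Measurable (gradient L) :=
  (InnerProductSpace.toDual ℝ (Pos d)).symm.continuous.measurable.comp (measurable_fderiv ℝ L)

lemma measurable_dir (L : Pos d → ℝ) : Measurable (dir L) :=
  ((measurable_gradient L).norm.inv.smul (measurable_gradient L)).neg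

lemma measurable_rapidity (L : Pos d → ℝ) (ε : ℝ) : Measurable (rapidity L ε) :=
  ((measurable_gradient L).norm.const_mul ε).div_const _

lemma measurable_stretch (L : Pos d → ℝ) (ε : ℝ) : Measurable (stretch L ε) := by
  have h1 := measurable_dir L
  have h2 := measurable_rapidity L ε
  unfold stretch; fun_prop

lemma measurable_deltaK (L : Pos d → ℝ) (ε : ℝ) : Measurable (deltaK L ε) :=
  (measurable_stretch L ε).log.const_mul _

lemma measurable_updateB (L : Pos d → ℝ) (ε : ℝ) : Measurable (updateB L ε) := by
  have h1 := measurable_dir L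
  have h2 := measurable_rapidity L ε
  have h3 := measurable_stretch L ε
  refine measurable_fst.prodMk (h3.inv.smul ?_)
  fun_prop

lemma measurable_extA {L : Pos d → ℝ} (hL : Measurable L) (ε : ℝ) : Measurable (extA L ε) := by
  have h1 := measurable_updateA (d := d) ε
  have h2 := measurable_deltaV hL ε
  unfold extA; fun_prop

lemma measurable_extB (L : Pos d → ℝ) (ε : ℝ) : Measurable (extB L ε) := by
  have h1 := measurable_updateB L ε
  have h2 := measurable_deltaK L ε
  unfold extB; fun_prop

/-- Scaling `v` contributes `exp (L x - L (x + ε u))`, which turns the density at `x` into the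
density at `x + ε u`; translation invariance does the rest. -/
lemma measurePreserving_extA {L : Pos d → ℝ} (hL : Measurable L) (ε : ℝ) :
    MeasurePreserving (extA L ε) (extMeasure L) (extMeasure L) := by
  refine measurePreserving_of_lintegral (measurable_extA hL ε) fun G hG => ?_
  rw [lintegral_extMeasure_vel L (F := fun y => G (extA L ε y))
    (hG.comp (measurable_extA hL ε)), lintegral_extMeasure_vel L hG]
  refine lintegral_congr fun u => ?_
  have hH : Measurable fun x : Pos d => ∫⁻ v, G ((x, u), v) := by fun_prop
  have h1 : ∀ x : Pos d, ∫⁻ v, G (extA L ε ((x, u), v)) =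
      ENNReal.ofReal (Real.exp (-(L (x + ε • u) - L x))) * ∫⁻ v, G ((x + ε • u, u), v) :=
    fun x => lintegral_mul_exp (G := fun v => G ((x + ε • u, u), v)) (by fun_prop) (deltaV L ε (x, u))
  simp_rw [h1, target]
  rw [lintegral_withDensity_eq_lintegral_mul _ (by fun_prop) (by fun_prop),
    lintegral_withDensity_eq_lintegral_mul _ (by fun_prop) hH]
  refine Eq.trans ?_ (lintegral_add_right_eq_self _ (ε • u))
  refine lintegral_congr fun x => ?_
  simp only [Pi.mul_apply]
  rw [← mul_assoc, ← ENNReal.ofReal_mul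
    (div_nonneg (Real.exp_nonneg _) (integral_nonneg fun _ => Real.exp_nonneg _)),
    div_mul_eq_mul_div, ← Real.exp_add]
  congr 4
  ring

lemma extA_flip_extA (L : Pos d → ℝ) (ε : ℝ) (y : Phase d × ℝ) :
    extA L ε (flip (extA L ε y)) = flip y := by
  simp only [extA, flip, updateA, deltaV, smul_neg, add_neg_cancel_right]
  rw [mul_assoc, ← Real.exp_add, sub_add_sub_cancel, sub_self, Real.exp_zero, mul_one]

/-- Where the gradient vanishes `dir` is not a unit vector, but there the rapidity is zero and the
update trivial. The lemmas on boosts cover the other case. -/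
lemma norm_dir_or_rapidity (L : Pos d → ℝ) (ε : ℝ) (x : Pos d) :
    ‖dir L x‖ = 1 ∨ rapidity L ε x = 0 := by
  rcases eq_or_ne (gradient L x) 0 with h | h
  · right; simp [rapidity, h]
  · left
    rw [dir, norm_neg, norm_smul, norm_inv, norm_norm, inv_mul_cancel₀ (norm_ne_zero_iff.2 h)]

lemma stretch_eq (L : Pos d → ℝ) (ε : ℝ) (x : Pos d) {u : Pos d} (hu : ‖u‖ = 1) :
    stretch L ε (x, u) = boostNorm (dir L x) (rapidity L ε x) u := by
  simp [stretch, boostNorm, hu]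

lemma updateB_eq (L : Pos d → ℝ) (ε : ℝ) (x : Pos d) {u : Pos d} (hu : ‖u‖ = 1) :
    updateB L ε (x, u) = (x, boostDir (dir L x) (rapidity L ε x) u) := by
  simp [updateB, stretch_eq L ε x hu, boostDir, boost, hu]

lemma boostNorm_zero (e u : Pos d) : boostNorm e 0 u = ‖u‖ := by simp [boostNorm]

lemma boostDir_zero (e : Pos d) {u : Pos d} (hu : ‖u‖ = 1) : boostDir e 0 u = u := by
  simp [boostDir, boostNorm_zero, hu, boost]

lemma stretch_pos (L : Pos d → ℝ) (ε : ℝ) (x : Pos d) {u : Pos d} (hu : ‖u‖ = 1) :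
    0 < stretch L ε (x, u) := by
  rw [stretch_eq L ε x hu]
  rcases norm_dir_or_rapidity L ε x with h | h
  · exact boostNorm_pos h _ (by rintro rfl; simp at hu)
  · rw [h, boostNorm_zero, hu]; exact one_pos

lemma norm_updateB (L : Pos d → ℝ) (ε : ℝ) (x : Pos d) {u : Pos d} (hu : ‖u‖ = 1) :
    ‖(updateB L ε (x, u)).2‖ = 1 := by
  rw [updateB_eq L ε x hu]
  rcases norm_dir_or_rapidity L ε x with h | h
  · exact norm_boostDir h _ (by rintro rfl; simp at hu)
  · simp [h, boostDir_zero, hu]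

lemma extB_flip_extB (L : Pos d → ℝ) (ε : ℝ) (y : Phase d × ℝ) (hy : ‖y.1.2‖ = 1) :
    extB L ε (flip (extB L ε y)) = flip y := by
  obtain ⟨⟨x, u⟩, v⟩ := y
  simp only at hy
  have hn := norm_updateB L ε x hy
  have hn' : ‖-(boostDir (dir L x) (rapidity L ε x) u)‖ = 1 := by
    rw [updateB_eq L ε x hy] at hn
    simpa using hn
  have hs : stretch L ε (x, -(boostDir (dir L x) (rapidity L ε x) u)) =
      (stretch L ε (x, u))⁻¹ := by
    rw [stretch_eq L ε x hn', stretch_eq L ε x hy]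
    rcases norm_dir_or_rapidity L ε x with h | h
    · exact boostNorm_neg_boostDir h _ hy
    · simp [h, boostNorm_zero, boostDir_zero, hy]
  have hb : boostDir (dir L x) (rapidity L ε x) (-(boostDir (dir L x) (rapidity L ε x) u)) =
      -u := by
    rcases norm_dir_or_rapidity L ε x with h | h
    · exact boostDir_neg_boostDir h _ hy
    · rw [h, boostDir_zero _ hy, boostDir_zero _ (by simpa using hy)]
  simp only [extB, flip, updateB_eq L ε x hy, deltaK, updateB_eq L ε x hn', hb, hs, Real.log_inv]
  rw [mul_assoc, ← Real.exp_add, mul_neg, add_neg_cancel, Real.exp_zero, mul_one]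

/-- The factor `exp (-deltaK)` is `stretch ^ (-(d - 1))`, precisely the Jacobian in
`lintegral_boostDir`. -/
lemma measurePreserving_extB (hd : 2 ≤ d) (L : Pos d → ℝ) (ε : ℝ) :
    MeasurePreserving (extB L ε) (extMeasure L) (extMeasure L) := by
  have := nontrivial_pos hd
  refine measurePreserving_of_lintegral (measurable_extB L ε) fun G hG => ?_
  rw [lintegral_extMeasure L (F := fun y => G (extB L ε y))
    (hG.comp (measurable_extB L ε)), lintegral_extMeasure L hG]
  refine lintegral_congr fun x => ?_
  have hH : Measurable fun u : Pos d => ∫⁻ v, G ((x, u), v) := by fun_prop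
  have h1 : ∀ u : Pos d, ∫⁻ v, G (extB L ε ((x, u), v)) =
      ENNReal.ofReal (Real.exp (-deltaK L ε (x, u))) * ∫⁻ v, G (updateB L ε (x, u), v) :=
    fun u => lintegral_mul_exp (G := fun v => G (updateB L ε (x, u), v)) (by fun_prop)
      (deltaK L ε (x, u))
  have h2 : ∀ᵐ u ∂uniformSphere d, ∫⁻ v, G (extB L ε ((x, u), v)) =
      ENNReal.ofReal (boostNorm (dir L x) (rapidity L ε x) u ^
        (Module.finrank ℝ (Pos d) - 1))⁻¹ *
          ∫⁻ v, G ((x, boostDir (dir L x) (rapidity L ε x) u), v) := by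
    filter_upwards [ae_norm_eq_one_uniformSphere d] with u hu
    -- The energy contains the real number `d - 1`, the Jacobian a truncated natural subtraction;
    -- they agree since `d ≥ 2`.
    rw [h1, updateB_eq L ε x hu, deltaK, ← stretch_eq L ε x hu, Real.exp_neg, finrank_euclideanSpace,
      Fintype.card_fin, mul_comm _ (Real.log _), Real.exp_mul, Real.exp_log (stretch_pos L ε x hu),
      ← Real.rpow_natCast, Nat.cast_pred (by omega)]
  rw [lintegral_congr_ae h2]
  rcases norm_dir_or_rapidity L ε x with h | h
  · rw [uniformSphere_eq, lintegral_smul_measure, lintegral_smul_measure,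
      lintegral_boostDir h _ hH]
  · refine lintegral_congr_ae ?_
    filter_upwards [ae_norm_eq_one_uniformSphere d] with u hu
    simp [h, boostNorm_zero, boostDir_zero, hu]

/-- The leapfrog step on the extended phase space. -/
def extLeapfrog (L : Pos d → ℝ) (ε : ℝ) (y : Phase d × ℝ) : Phase d × ℝ :=
  (leapfrog L ε y.1, y.2 * Real.exp (energyError L ε y.1))

lemma extLeapfrog_eq (L : Pos d → ℝ) (ε : ℝ) (y : Phase d × ℝ) :
    extLeapfrog L ε y = extB L (ε / 2) (extA L ε (extB L (ε / 2) y)) := by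
  simp [extLeapfrog, extB, extA, leapfrog, energyError, Real.exp_add, mul_assoc]

lemma measurable_extLeapfrog {L : Pos d → ℝ} (hL : Measurable L) (ε : ℝ) :
    Measurable (extLeapfrog L ε) := by
  rw [funext (extLeapfrog_eq L ε)]
  exact (measurable_extB L _).comp ((measurable_extA hL ε).comp (measurable_extB L _))

/-- `B A B` is a palindrome, so the reversal of factors gives back the same operator. -/
lemma skewAdjoint_extLeapfrog (hd : 2 ≤ d) {L : Pos d → ℝ} (hL : Measurable L) (ε : ℝ) :
    SkewAdjoint (extMeasure L) flip (fun G => G ∘ extLeapfrog L ε)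
      (fun G => G ∘ extLeapfrog L ε) := by
  have hJ := measurePreserving_flip hd L
  have hB := skewAdjoint_comp_right hJ (measurePreserving_extB hd L (ε / 2))
    ((ae_extMeasure_norm L).mono fun y hy => extB_flip_extB L _ y hy)
  have hA := skewAdjoint_comp_right hJ (measurePreserving_extA hL ε)
    (Filter.Eventually.of_forall fun y => extA_flip_extA L ε y)
  have hBm : PreservesMeasurable fun G => G ∘ extB L (ε / 2) :=
    fun G hG => hG.comp (measurable_extB L _)
  have hAm : PreservesMeasurable fun G => G ∘ extA L ε := fun G hG => hG.comp (measurable_extA hL ε)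
  have h := hB.comp hJ flip_involutive hBm (hAm.comp hBm)
    (hA.comp hJ flip_involutive hAm hBm hB)
  have heq : (fun G : Phase d × ℝ → ENNReal => G ∘ extLeapfrog L ε) =
      (fun G => G ∘ extB L (ε / 2)) ∘ (fun G => G ∘ extA L ε) ∘ (fun G => G ∘ extB L (ε / 2)) := by
    ext G y
    simp [extLeapfrog_eq]
  rw [heq]
  exact h

/-! ### The partial refreshment. -/

/-- The Markov operator of the partial refreshment on the extended phase space. -/
def refreshOp (ε Lp : ℝ) (G : Phase d × ℝ → ENNReal) (y : Phase d × ℝ) : ENNReal :=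
  ∫⁻ g, G (partialRefresh ε Lp g y.1, y.2) ∂stdGaussian (Pos d)

lemma measurable_partialRefresh (ε Lp : ℝ) :
    Measurable fun q : Pos d × Phase d => partialRefresh ε Lp q.1 q.2 := by
  unfold partialRefresh
  refine (measurable_fst.comp measurable_snd).prodMk ?_
  have h : Measurable fun q : Pos d × Phase d =>
      Real.exp (-ε / Lp) • q.2.2 + (√(1 - Real.exp (-ε / Lp) ^ 2) / √(d : ℝ)) • q.1 := by
    fun_prop
  exact h.norm.inv.smul h

lemma preservesMeasurable_refreshOp (ε Lp : ℝ) :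
    PreservesMeasurable (refreshOp (d := d) ε Lp) := by
  intro G hG
  have h1 := measurable_partialRefresh (d := d) ε Lp
  have h2 : Measurable fun q : (Phase d × ℝ) × Pos d =>
      G (partialRefresh ε Lp q.2 q.1.1, q.1.2) :=
    hG.comp ((h1.comp (measurable_snd.prodMk (measurable_fst.comp measurable_fst))).prodMk
      (measurable_snd.comp measurable_fst))
  exact h2.lintegral_prod_right'

/-- Detailed balance for a random walk on the sphere with normal increments. -/
lemma lintegral_uniformSphere_refresh (hd : 2 ≤ d) (c : ℝ) {a : ℝ} (ha : a ≠ 0)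
    {f h : Pos d → ENNReal} (hf : Measurable f) (hh : Measurable h) :
    ∫⁻ u, f u * ∫⁻ g, h (‖c • u + a • g‖⁻¹ • (c • u + a • g)) ∂stdGaussian (Pos d)
      ∂uniformSphere d =
    ∫⁻ u, h (-u) * ∫⁻ g, f (-(‖c • u + a • g‖⁻¹ • (c • u + a • g))) ∂stdGaussian (Pos d)
      ∂uniformSphere d := by
  have := nontrivial_pos hd
  obtain ⟨k, hk, hkd⟩ := exists_density_direction (E := Pos d) c ha
  simp only [uniformSphere_eq, lintegral_smul_measure]
  congr 1
  have h1 : ∫⁻ u, f u * ∫⁻ g, h (‖c • u + a • g‖⁻¹ • (c • u + a • g)) ∂stdGaussian (Pos d)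
      ∂sphereMeasure (Pos d) =
      ∫⁻ u, ∫⁻ w, f u * (k (inner ℝ u w) * h w) ∂sphereMeasure (Pos d) ∂sphereMeasure (Pos d) := by
    refine lintegral_congr_ae ?_
    filter_upwards [ae_norm_eq_one_sphereMeasure (Pos d)] with u hu
    rw [hkd u hu h hh, lintegral_const_mul _ (by fun_prop)]
  have h2 : ∫⁻ u, h (-u) * ∫⁻ g, f (-(‖c • u + a • g‖⁻¹ • (c • u + a • g))) ∂stdGaussian (Pos d)
      ∂sphereMeasure (Pos d) = ∫⁻ u, ∫⁻ w, h (-u) * (k (inner ℝ (-u) w) * f w)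
        ∂sphereMeasure (Pos d) ∂sphereMeasure (Pos d) := by
    refine lintegral_congr_ae ?_
    filter_upwards [ae_norm_eq_one_sphereMeasure (Pos d)] with u hu
    rw [hkd u hu (fun w => f (-w)) (by fun_prop), lintegral_const_mul _ (by fun_prop),
      ← lintegral_sphereMeasure_neg (by fun_prop)]
    simp
  -- After `u ↦ -u` both sides are double integrals with the kernel `k ⟨u, w⟩`, symmetric under
  -- exchange of `u` and `w`.
  rw [h1, h2, lintegral_sphereMeasure_neg (f := fun u => ∫⁻ w, h u * (k (inner ℝ u w) * f w)
    ∂sphereMeasure (Pos d)) (by fun_prop), lintegral_lintegral_swap (by fun_prop)]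
  refine lintegral_congr fun u => lintegral_congr fun w => ?_
  rw [real_inner_comm]
  ring

lemma skewAdjoint_refreshOp (hd : 2 ≤ d) (L : Pos d → ℝ) {ε Lp : ℝ} (hε : 0 < ε) (hLp : 0 < Lp) :
    SkewAdjoint (extMeasure L) flip (refreshOp ε Lp) (refreshOp ε Lp) := by
  intro F G hF hG
  have hm := preservesMeasurable_refreshOp (d := d) ε Lp
  rw [lintegral_extMeasure_weight L (F := fun y => F y * refreshOp ε Lp G y) (hF.mul (hm G hG)),
    lintegral_extMeasure_weight L (F := fun y => G (flip y) * refreshOp ε Lp (F ∘ flip) y)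
      ((hG.comp measurable_flip).mul (hm _ (hF.comp measurable_flip)))]
  refine lintegral_congr fun x => lintegral_congr fun v => ?_
  -- Since `ε / Lp > 0`, `c₂` is nonzero: the noise is nondegenerate and the refreshed direction has
  -- a density.
  have ha : √(1 - Real.exp (-ε / Lp) ^ 2) / √(d : ℝ) ≠ 0 := by
    have h1 : Real.exp (-ε / Lp) < 1 := by
      rw [Real.exp_lt_one_iff, neg_div, neg_lt_zero]; positivity
    have h2 : Real.exp (-ε / Lp) ^ 2 < 1 := pow_lt_one₀ (Real.exp_nonneg _) h1 two_ne_zero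
    have h3 : (0 : ℝ) < d := by exact_mod_cast (by omega : 0 < d)
    exact (div_pos (Real.sqrt_pos.2 (sub_pos.2 h2)) (Real.sqrt_pos.2 h3)).ne'
  exact lintegral_uniformSphere_refresh hd (Real.exp (-ε / Lp)) ha
    (f := fun u => F ((x, u), v)) (h := fun u => G ((x, u), v)) (by fun_prop) (by fun_prop)

end ExtendedSpace

/-! ### Trajectories, acceptance and detailed balance. -/

section Transition

variable {d : ℕ}

/-- The Markov operator of one `O Φ O` step on the extended phase space. -/
def stepOp (L : Pos d → ℝ) (ε Lp : ℝ) :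
    (Phase d × ℝ → ENNReal) → Phase d × ℝ → ENNReal :=
  refreshOp ε Lp ∘ (fun G => G ∘ extLeapfrog L ε) ∘ refreshOp ε Lp

lemma preservesMeasurable_stepOp {L : Pos d → ℝ} (hL : Measurable L) (ε Lp : ℝ) :
    PreservesMeasurable (stepOp L ε Lp) := by
  have hO := preservesMeasurable_refreshOp (d := d) ε Lp
  have hΦ : PreservesMeasurable fun G => G ∘ extLeapfrog L ε :=
    fun G hG => hG.comp (measurable_extLeapfrog hL ε)
  exact hO.comp (hΦ.comp hO)

lemma skewAdjoint_stepOp (hd : 2 ≤ d) {L : Pos d → ℝ} (hL : Measurable L) {ε Lp : ℝ}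
    (hε : 0 < ε) (hLp : 0 < Lp) :
    SkewAdjoint (extMeasure L) flip (stepOp L ε Lp) (stepOp L ε Lp) := by
  have hJ := measurePreserving_flip hd L
  have hO := preservesMeasurable_refreshOp (d := d) ε Lp
  have hΦ : PreservesMeasurable fun G => G ∘ extLeapfrog L ε :=
    fun G hG => hG.comp (measurable_extLeapfrog hL ε)
  have hOs := skewAdjoint_refreshOp hd L hε hLp
  have h := hOs.comp hJ flip_involutive hO (hΦ.comp hO)
    ((skewAdjoint_extLeapfrog hd hL ε).comp hJ flip_involutive hΦ hO hOs)
  exact h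

lemma measurable_leapfrog (L : Pos d → ℝ) (ε : ℝ) : Measurable (leapfrog L ε) :=
  (measurable_updateB L _).comp ((measurable_updateA ε).comp (measurable_updateB L _))

lemma measurable_energyError {L : Pos d → ℝ} (hL : Measurable L) (ε : ℝ) :
    Measurable (energyError L ε) :=
  ((measurable_deltaK L _).add ((measurable_deltaV hL ε).comp (measurable_updateB L _))).add
    ((measurable_deltaK L _).comp ((measurable_updateA ε).comp (measurable_updateB L _)))

lemma measurable_trajectory {L : Pos d → ℝ} (hL : Measurable L) (ε Lp : ℝ) (n : ℕ) :
    Measurable fun q : (Fin n → Pos d × Pos d) × Phase d => trajectory L ε Lp n q.1 q.2 := by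
  induction n with
  | zero => exact measurable_snd.prodMk measurable_const
  | succ n ih =>
    have hR := measurable_partialRefresh (d := d) ε Lp
    have hΦ := measurable_leapfrog L ε
    have hE := measurable_energyError hL ε
    have h1 : Measurable fun q : (Fin (n + 1) → Pos d × Pos d) × Phase d =>
        trajectory L ε Lp n (fun i => q.1 i.castSucc) q.2 := by
      refine ih.comp (Measurable.prodMk ?_ measurable_snd)
      fun_prop
    have h2 : Measurable fun q : (Fin (n + 1) → Pos d × Pos d) × Phase d => q.1 (Fin.last n) := by
      fun_prop
    have h3 : Measurable fun q : (Fin (n + 1) → Pos d × Pos d) × Phase d =>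
        partialRefresh ε Lp (q.1 (Fin.last n)).1
          (trajectory L ε Lp n (fun i => q.1 i.castSucc) q.2).1 :=
      hR.comp (h2.fst.prodMk h1.fst)
    exact (hR.comp (h2.snd.prodMk (hΦ.comp h3))).prodMk (h1.snd.add (hE.comp h3))

variable (d) in
/-- The law of the normal vectors of `n` steps. -/
abbrev normalLaw (n : ℕ) : Measure (Fin n → Pos d × Pos d) :=
  Measure.pi fun _ => (stdGaussian (Pos d)).prod (stdGaussian (Pos d))

/-- The Markov operator of a trajectory of `n` steps on the extended phase space. -/
def trajectoryOp (L : Pos d → ℝ) (ε Lp : ℝ) (n : ℕ) (G : Phase d × ℝ → ENNReal)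
    (y : Phase d × ℝ) : ENNReal :=
  ∫⁻ g, G ((trajectory L ε Lp n g y.1).1, y.2 * Real.exp (trajectory L ε Lp n g y.1).2)
    ∂normalLaw d n

lemma stepOp_apply {L : Pos d → ℝ} (hL : Measurable L) (ε Lp : ℝ) {G : Phase d × ℝ → ENNReal}
    (hG : Measurable G) (y : Phase d × ℝ) :
    stepOp L ε Lp G y = ∫⁻ g, G (partialRefresh ε Lp g.2 (leapfrog L ε
      (partialRefresh ε Lp g.1 y.1)), y.2 * Real.exp (energyError L ε (partialRefresh ε Lp g.1 y.1)))
        ∂(stdGaussian (Pos d)).prod (stdGaussian (Pos d)) := by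
  have hR := measurable_partialRefresh (d := d) ε Lp
  have h1 : Measurable fun g : Pos d × Pos d => partialRefresh ε Lp g.1 y.1 :=
    hR.comp (measurable_fst.prodMk measurable_const)
  have h2 : Measurable fun g : Pos d × Pos d =>
      partialRefresh ε Lp g.2 (leapfrog L ε (partialRefresh ε Lp g.1 y.1)) :=
    hR.comp (measurable_snd.prodMk ((measurable_leapfrog L ε).comp h1))
  have h3 := (measurable_energyError hL ε).comp h1
  rw [lintegral_prod]
  · rfl
  · exact (hG.comp (h2.prodMk (h3.exp.const_mul y.2))).aemeasurable

/-- Integrating out the last pair of normal vectors applies `stepOp` to `G`; the first `n` steps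
then act on the result. Energy errors add, so the factors of `v` multiply. -/
lemma trajectoryOp_eq_iterate {L : Pos d → ℝ} (hL : Measurable L) (ε Lp : ℝ) (n : ℕ) :
    ∀ {G : Phase d × ℝ → ENNReal}, Measurable G →
      trajectoryOp L ε Lp n G = (stepOp L ε Lp)^[n] G := by
  induction n with
  | zero =>
    intro G _
    ext y
    simp [trajectoryOp, trajectory]
  | succ n ih =>
    intro G hG
    rw [Function.iterate_succ_apply, ← ih (preservesMeasurable_stepOp hL ε Lp G hG)]
    ext y
    have hp := measurePreserving_piFinSuccAbove (fun _ : Fin (n + 1) =>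
      (stdGaussian (Pos d)).prod (stdGaussian (Pos d))) (Fin.last n)
    set H : (Pos d × Pos d) × (Fin n → Pos d × Pos d) → ENNReal := fun q =>
      G (partialRefresh ε Lp q.1.2 (leapfrog L ε
          (partialRefresh ε Lp q.1.1 (trajectory L ε Lp n q.2 y.1).1)),
        y.2 * Real.exp ((trajectory L ε Lp n q.2 y.1).2 + energyError L ε
          (partialRefresh ε Lp q.1.1 (trajectory L ε Lp n q.2 y.1).1))) with hH
    have hHm : Measurable H := by
      have hR := measurable_partialRefresh (d := d) ε Lp
      have h1 : Measurable fun q : (Pos d × Pos d) × (Fin n → Pos d × Pos d) =>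
          trajectory L ε Lp n q.2 y.1 :=
        (measurable_trajectory hL ε Lp n).comp (measurable_snd.prodMk measurable_const)
      have h2 := hR.comp ((measurable_fst.comp measurable_fst).prodMk h1.fst)
      have h3 := hR.comp ((measurable_snd.comp measurable_fst).prodMk
        ((measurable_leapfrog L ε).comp h2))
      have h4 := (h1.snd.add ((measurable_energyError hL ε).comp h2)).exp.const_mul y.2
      exact hG.comp (h3.prodMk h4)
    have h1 := hp.lintegral_comp hHm
    have h2 : trajectoryOp L ε Lp (n + 1) G y = ∫⁻ g, H (MeasurableEquiv.piFinSuccAbove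
        (fun _ => Pos d × Pos d) (Fin.last n) g) ∂normalLaw d (n + 1) := by
      refine lintegral_congr fun g => ?_
      simp only [hH, trajectory, MeasurableEquiv.piFinSuccAbove_apply, Fin.insertNthEquiv_symm_apply,
        Fin.removeNth_last]
      rfl
    rw [h2, h1, lintegral_prod_symm' _ hHm, trajectoryOp]
    refine lintegral_congr fun g => ?_
    rw [stepOp_apply hL ε Lp hG]
    refine lintegral_congr fun a => ?_
    simp only [hH, Real.exp_add, mul_assoc]

instance isProbabilityMeasure_unitInterval :
    IsProbabilityMeasure (volume.restrict (Set.Ioo (0 : ℝ) 1)) := ⟨by simp⟩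

lemma isProbabilityMeasure_noiseLaw (hd : 2 ≤ d) (n : ℕ) :
    IsProbabilityMeasure (noiseLaw d n) := by
  have := isProbabilityMeasure_uniformSphere hd
  unfold noiseLaw
  infer_instance

lemma measurable_step {L : Pos d → ℝ} (hL : Measurable L) (ε Lp : ℝ) (n : ℕ) :
    Measurable fun q : Pos d × Noise d n => step L ε Lp n q.1 q.2 := by
  have h1 : Measurable fun q : Pos d × Noise d n =>
      trajectory L ε Lp n q.2.2.1 (q.1, q.2.1) :=
    (measurable_trajectory hL ε Lp n).comp (by fun_prop :
      Measurable fun q : Pos d × Noise d n => (q.2.2.1, ((q.1, q.2.1) : Phase d)))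
  exact Measurable.ite (measurableSet_lt (by fun_prop) h1.snd.neg.exp) h1.fst.fst measurable_fst

/-- The transition kernel of the algorithm. -/
def transition {L : Pos d → ℝ} (hL : Measurable L) (ε Lp : ℝ) (n : ℕ) : Kernel (Pos d) (Pos d) where
  toFun x := (noiseLaw d n).map (step L ε Lp n x)
  measurable' := by
    have : SFinite (noiseLaw d n) := by unfold noiseLaw; infer_instance
    have h := (Measure.measurable_map _ (measurable_step hL ε Lp n)).comp
      (Measurable.map_prodMk_left (α := Pos d) (ν := noiseLaw d n))
    convert h using 2 with x
    rw [Function.comp_apply, Measure.map_map (measurable_step hL ε Lp n) measurable_prodMk_left]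
    rfl

lemma transition_apply {L : Pos d → ℝ} (hL : Measurable L) (ε Lp : ℝ) (n : ℕ) (x : Pos d) :
    transition hL ε Lp n x = (noiseLaw d n).map (step L ε Lp n x) := rfl

lemma measurable_step_right {L : Pos d → ℝ} (hL : Measurable L) (ε Lp : ℝ) (n : ℕ) (x : Pos d) :
    Measurable (step L ε Lp n x) :=
  (measurable_step hL ε Lp n).comp measurable_prodMk_left

lemma isMarkovKernel_transition (hd : 2 ≤ d) {L : Pos d → ℝ} (hL : Measurable L) (ε Lp : ℝ)
    (n : ℕ) : IsMarkovKernel (transition hL ε Lp n) := by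
  have := isProbabilityMeasure_noiseLaw hd n
  exact ⟨fun x => Measure.isProbabilityMeasure_map (measurable_step_right hL ε Lp n x).aemeasurable⟩

/-- The indicator of the extended phase points with position in `A` and last coordinate in the unit
interval. -/
def slab (A : Set (Pos d)) : Phase d × ℝ → ENNReal :=
  fun y => A.indicator 1 y.1.1 * (Set.Ioo (0 : ℝ) 1).indicator 1 y.2

lemma measurable_slab {A : Set (Pos d)} (hA : MeasurableSet A) : Measurable (slab A) := by
  have h1 : Measurable (A.indicator (1 : Pos d → ENNReal)) := measurable_one.indicator hA
  have h2 : Measurable ((Set.Ioo (0 : ℝ) 1).indicator (1 : ℝ → ENNReal)) :=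
    measurable_one.indicator measurableSet_Ioo
  unfold slab
  fun_prop

/-- The probability of rejection. -/
def rejection (L : Pos d → ℝ) (ε Lp : ℝ) (n : ℕ) (x : Pos d) : ENNReal :=
  noiseLaw d n {ξ | Real.exp (-(trajectory L ε Lp n ξ.2.1 (x, ξ.1)).2) ≤ ξ.2.2}

/-- The acceptance variable becomes the initial value of `v`, so the accepted part is expressed by
`trajectoryOp` and `slab`; the rejected part sits at `x`. -/
lemma transition_eq_add {L : Pos d → ℝ} (hL : Measurable L) (ε Lp : ℝ) (n : ℕ) (x : Pos d)
    {B : Set (Pos d)} (hB : MeasurableSet B) :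
    transition hL ε Lp n x B =
      (∫⁻ u, ∫⁻ v, (Set.Ioo (0 : ℝ) 1).indicator 1 v * trajectoryOp L ε Lp n (slab B) ((x, u), v)
        ∂volume ∂uniformSphere d) + B.indicator 1 x * rejection L ε Lp n x := by
  have hu : Measurable fun ξ : Noise d n => trajectory L ε Lp n ξ.2.1 (x, ξ.1) :=
    (measurable_trajectory hL ε Lp n).comp (by fun_prop :
      Measurable fun ξ : Noise d n => (ξ.2.1, ((x, ξ.1) : Phase d)))
  have hrej : MeasurableSet
      {ξ : Noise d n | Real.exp (-(trajectory L ε Lp n ξ.2.1 (x, ξ.1)).2) ≤ ξ.2.2} :=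
    measurableSet_le hu.snd.neg.exp (by fun_prop)
  have hUioo : ∀ᵐ ξ ∂noiseLaw d n, ξ.2.2 ∈ Set.Ioo (0 : ℝ) 1 :=
    Measure.quasiMeasurePreserving_snd.ae (Measure.quasiMeasurePreserving_snd.ae
      (ae_restrict_mem measurableSet_Ioo))
  have hacc : Measurable fun ξ : Noise d n => slab B ((trajectory L ε Lp n ξ.2.1 (x, ξ.1)).1,
      ξ.2.2 * Real.exp (trajectory L ε Lp n ξ.2.1 (x, ξ.1)).2) :=
    (measurable_slab hB).comp (hu.fst.prodMk (Measurable.mul (by fun_prop) hu.snd.exp))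
  have hsplit : ∀ᵐ ξ ∂noiseLaw d n, B.indicator (1 : Pos d → ENNReal) (step L ε Lp n x ξ) =
      slab B ((trajectory L ε Lp n ξ.2.1 (x, ξ.1)).1,
        ξ.2.2 * Real.exp (trajectory L ε Lp n ξ.2.1 (x, ξ.1)).2) +
      B.indicator 1 x * {ξ : Noise d n | Real.exp (-(trajectory L ε Lp n ξ.2.1 (x, ξ.1)).2) ≤
        ξ.2.2}.indicator 1 ξ := by
    filter_upwards [hUioo] with ξ hξ
    have hiff : ξ.2.2 * Real.exp (trajectory L ε Lp n ξ.2.1 (x, ξ.1)).2 ∈ Set.Ioo (0 : ℝ) 1 ↔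
        ξ.2.2 < Real.exp (-(trajectory L ε Lp n ξ.2.1 (x, ξ.1)).2) := by
      rw [Set.mem_Ioo, Real.exp_neg, ← one_div, lt_div_iff₀ (Real.exp_pos _)]
      exact and_iff_right (mul_pos hξ.1 (Real.exp_pos _))
    by_cases h : ξ.2.2 < Real.exp (-(trajectory L ε Lp n ξ.2.1 (x, ξ.1)).2)
    · have h1 : ξ ∉ {ξ : Noise d n | Real.exp (-(trajectory L ε Lp n ξ.2.1 (x, ξ.1)).2) ≤
        ξ.2.2} := not_le.2 h
      rw [Set.indicator_of_notMem h1, mul_zero, add_zero, slab,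
        Set.indicator_of_mem (hiff.2 h), Pi.one_apply, mul_one, step, if_pos h]
    · have h1 : ξ ∈ {ξ : Noise d n | Real.exp (-(trajectory L ε Lp n ξ.2.1 (x, ξ.1)).2) ≤
        ξ.2.2} := not_lt.1 h
      rw [Set.indicator_of_mem h1, slab, Set.indicator_of_notMem (fun h' => h (hiff.1 h')),
        mul_zero, zero_add, Pi.one_apply, mul_one, step, if_neg h]
  rw [transition_apply, ← lintegral_indicator_one hB,
    lintegral_map (measurable_one.indicator hB) (measurable_step_right hL ε Lp n x),
    lintegral_congr_ae hsplit, lintegral_add_left hacc,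
    lintegral_const_mul _ (measurable_one.indicator hrej), lintegral_indicator_one hrej, rejection]
  congr 1
  rw [noiseLaw, lintegral_prod _ hacc.aemeasurable]
  refine lintegral_congr fun u => ?_
  have hacc' : Measurable fun q : (Fin n → Pos d × Pos d) × ℝ =>
      slab B ((trajectory L ε Lp n q.1 (x, u)).1,
        q.2 * Real.exp (trajectory L ε Lp n q.1 (x, u)).2) :=
    hacc.comp measurable_prodMk_left
  rw [lintegral_prod_symm' _ hacc', ← lintegral_indicator measurableSet_Ioo]
  refine lintegral_congr fun v => ?_
  by_cases hv : v ∈ Set.Ioo (0 : ℝ) 1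
  · rw [Set.indicator_of_mem hv, Set.indicator_of_mem hv, Pi.one_apply, one_mul, trajectoryOp]
  · rw [Set.indicator_of_notMem hv, Set.indicator_of_notMem hv, zero_mul]

/-- The rejection term is visibly symmetric in `A` and `B`, which leaves detailed balance to the
pairing of slabs. -/
lemma setLIntegral_transition (hd : 2 ≤ d) {L : Pos d → ℝ} (hL : Measurable L) (ε Lp : ℝ) (n : ℕ)
    {A B : Set (Pos d)} (hA : MeasurableSet A) (hB : MeasurableSet B) :
    ∫⁻ x in A, transition hL ε Lp n x B ∂target L =
      ∫⁻ y, slab A y * (stepOp L ε Lp)^[n] (slab B) y ∂extMeasure L +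
        ∫⁻ x in A ∩ B, rejection L ε Lp n x ∂target L := by
  have := isProbabilityMeasure_noiseLaw hd n
  have hT : Measurable (trajectoryOp L ε Lp n (slab B)) := by
    rw [trajectoryOp_eq_iterate hL ε Lp n (measurable_slab hB)]
    exact (preservesMeasurable_stepOp hL ε Lp).iterate n _ (measurable_slab hB)
  have hI : Measurable ((Set.Ioo (0 : ℝ) 1).indicator (1 : ℝ → ENNReal)) :=
    measurable_one.indicator measurableSet_Ioo
  have hm : Measurable fun x : Pos d => ∫⁻ u, ∫⁻ v, (Set.Ioo (0 : ℝ) 1).indicator 1 v *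
      trajectoryOp L ε Lp n (slab B) ((x, u), v) ∂volume ∂uniformSphere d := by
    fun_prop
  simp_rw [transition_eq_add hL ε Lp n _ hB]
  rw [lintegral_add_left hm, ← trajectoryOp_eq_iterate hL ε Lp n (measurable_slab hB),
    lintegral_extMeasure L (F := fun y => slab A y * trajectoryOp L ε Lp n (slab B) y)
      ((measurable_slab hA).mul hT)]
  congr 1
  · rw [← lintegral_indicator hA]
    refine lintegral_congr fun x => ?_
    by_cases hx : x ∈ A
    · simp [slab, hx]
    · simp [slab, hx]
  · rw [Set.inter_comm, ← Measure.restrict_restrict hB, ← lintegral_indicator hB]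
    refine lintegral_congr fun x => ?_
    by_cases hx : x ∈ B <;> simp [hx]

/-- Detailed balance of the algorithm. -/
lemma isReversible_transition (hd : 2 ≤ d) {L : Pos d → ℝ} (hL : Measurable L) {ε Lp : ℝ}
    (hε : 0 < ε) (hLp : 0 < Lp) (n : ℕ) :
    (transition hL ε Lp n).IsReversible (target L) := by
  intro A B hA hB
  have h := (skewAdjoint_stepOp hd hL hε hLp).iterate (measurePreserving_flip hd L)
    flip_involutive (preservesMeasurable_stepOp hL ε Lp) n (slab A) (slab B) (measurable_slab hA)
    (measurable_slab hB)
  rw [setLIntegral_transition hd hL ε Lp n hA hB, setLIntegral_transition hd hL ε Lp n hB hA, h,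
    Set.inter_comm]
  -- A slab does not involve the velocity, so `flip` disappears.
  rfl

lemma isProbabilityMeasure_target {L : Pos d → ℝ} (hint : Integrable fun x => Real.exp (-L x)) :
    IsProbabilityMeasure (target L) := by
  have hZ : 0 < ∫ y, Real.exp (-L y) := integral_exp_pos hint
  refine ⟨?_⟩
  rw [target, withDensity_apply _ .univ, Measure.restrict_univ,
    ← ofReal_integral_eq_lintegral_ofReal (hint.div_const _)
      (Filter.Eventually.of_forall fun x => div_nonneg (Real.exp_nonneg _) hZ.le),
    integral_div, div_self hZ.ne', ENNReal.ofReal_one]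

end Transition

/-! ### The Markov property. -/

section MarkovChain

/-- The law of a function of a variable `X` and of an independent noise, on an event that is
independent of the noise. -/
lemma measure_inter_eq_setLIntegral {Ω β γ δ : Type*} [MeasurableSpace β] [MeasurableSpace γ]
    [MeasurableSpace δ] {m m0 : MeasurableSpace Ω} {P : Measure Ω} [IsProbabilityMeasure P] (hm : m ≤ m0) {X : Ω → β} (hX : Measurable[m] X) {ξ : Ω → γ}
    (hξ : Measurable ξ) (hind : Indep m (MeasurableSpace.comap ξ inferInstance) P) {s : β → γ → δ}
    (hs : Measurable fun q : β × γ => s q.1 q.2) {S : Set Ω} (hS : MeasurableSet[m] S) {A : Set δ}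
    (hA : MeasurableSet A) :
    P (S ∩ {ω | s (X ω) (ξ ω) ∈ A}) = ∫⁻ ω in S, (P.map ξ).map (s (X ω)) A ∂P := by
  have := Measure.isProbabilityMeasure_map (μ := P) hξ.aemeasurable
  have hX0 : Measurable X := hX.mono hm le_rfl
  have hS0 : MeasurableSet S := hm _ hS
  -- Recording membership in `S` beside `X` puts both into one `m`-measurable variable, whose joint
  -- law with the noise is a product.
  have hYm : Measurable[m] fun ω => (X ω, ω ∈ S) := by
    have hSm : Measurable[m] fun ω => ω ∈ S := (@measurable_mem Ω S m).2 hS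
    exact hX.prodMk hSm
  have hY : Measurable fun ω => (X ω, ω ∈ S) := hYm.mono hm le_rfl
  have hindep : IndepFun (fun ω => (X ω, ω ∈ S)) ξ P :=
    indep_of_indep_of_le_left hind hYm.comap_le
  rw [indepFun_iff_map_prod_eq_prod_map_map (by fun_prop) (by fun_prop)] at hindep
  have hD : MeasurableSet {q : (β × Prop) × γ | q.1.2 ∧ s q.1.1 q.2 ∈ A} := by
    refine MeasurableSet.inter ?_ ?_
    · exact measurableSet_setOfPred.2 (by fun_prop)
    · exact (hs.comp (by fun_prop : Measurable fun q : (β × Prop) × γ => (q.1.1, q.2))) hA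
  have h1 : P (S ∩ {ω | s (X ω) (ξ ω) ∈ A}) = P.map (fun ω => ((X ω, ω ∈ S), ξ ω))
      {q : (β × Prop) × γ | q.1.2 ∧ s q.1.1 q.2 ∈ A} := by
    rw [Measure.map_apply (hY.prodMk hξ) hD]
    rfl
  rw [h1, hindep, Measure.prod_apply hD, lintegral_map (measurable_measure_prodMk_left hD) hY,
    ← lintegral_indicator hS0]
  refine lintegral_congr fun ω => ?_
  have hsX : Measurable (s (X ω)) := hs.comp measurable_prodMk_left
  by_cases hω : ω ∈ S
  · rw [Set.indicator_of_mem hω, Measure.map_apply hsX hA]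
    congr 1
    ext c
    simp [hω]
  · rw [Set.indicator_of_notMem hω]
    simp [hω]

/-- The conditional distribution of a function of a variable `X` and of an independent noise. -/
lemma condExp_indicator_eq {Ω β γ δ : Type*} [MeasurableSpace β] [MeasurableSpace γ]
    [MeasurableSpace δ] {m m0 : MeasurableSpace Ω} {P : Measure Ω} [IsProbabilityMeasure P]
    (hm : m ≤ m0) {X : Ω → β} (hX : Measurable[m] X) {ξ : Ω → γ}
    (hξ : Measurable ξ) (hind : Indep m (MeasurableSpace.comap ξ inferInstance) P) {s : β → γ → δ}
    (hs : Measurable fun q : β × γ => s q.1 q.2) (κ : Kernel β δ) [IsMarkovKernel κ]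
    (hκs : ∀ x, κ x = (P.map ξ).map (s x)) {A : Set δ} (hA : MeasurableSet A) :
    P[((fun ω => s (X ω) (ξ ω)) ⁻¹' A).indicator (fun _ => (1 : ℝ)) | m]
      =ᵐ[P] fun ω => (κ (X ω)).real A := by
  have hX0 : Measurable X := hX.mono hm le_rfl
  have hκ : Measurable fun x => (κ x).real A := (κ.measurable_coe hA).ennreal_toReal
  have hκm : Measurable[m] fun ω => (κ (X ω)).real A := hκ.comp hX
  have hκint : Integrable (fun ω => (κ (X ω)).real A) P :=
    Integrable.of_bound (hκ.comp hX0).aestronglyMeasurable 1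
      (Filter.Eventually.of_forall fun ω => by
        rw [Real.norm_of_nonneg measureReal_nonneg]; exact measureReal_le_one)
  have hpre : MeasurableSet ((fun ω => s (X ω) (ξ ω)) ⁻¹' A) := hs.comp (hX0.prodMk hξ) hA
  refine (ae_eq_condExp_of_forall_setIntegral_eq hm ((integrable_const (1 : ℝ)).indicator hpre)
    (fun S _ _ => hκint.integrableOn) (fun S hS _ => ?_)
    hκm.stronglyMeasurable.aestronglyMeasurable).symm
  -- The defining identity of the conditional expectation on `S`, for measures in `ENNReal`; it
  -- remains to pass to real integrals.
  have key := measure_inter_eq_setLIntegral hm hX hξ hind hs hS hA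
  simp only [← hκs] at key
  rw [setIntegral_indicator hpre, setIntegral_const, smul_eq_mul, mul_one]
  simp only [measureReal_def]
  have hκX : Measurable fun ω => κ (X ω) A := (κ.measurable_coe hA).comp hX0
  rw [integral_toReal hκX.aemeasurable
    (Filter.Eventually.of_forall fun ω => measure_lt_top _ _)]
  exact congrArg ENNReal.toReal key.symm

variable {d : ℕ} {Ω : Type*} [MeasurableSpace Ω] {P : Measure Ω} [IsProbabilityMeasure P]

/-- A pair of independent variables is independent of a third one that is independent of the
second, if the first is independent of the other two. -/
lemma indepFun_prodMk_left {β γ δ : Type*} [MeasurableSpace β] [MeasurableSpace γ]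
    [MeasurableSpace δ] {f : Ω → β} {g : Ω → γ} {h : Ω → δ} (hf : Measurable f)
    (hg : Measurable g) (hh : Measurable h) (h1 : IndepFun f (fun ω => (g ω, h ω)) P)
    (h2 : IndepFun g h P) : IndepFun (fun ω => (f ω, g ω)) h P := by
  have := Measure.isProbabilityMeasure_map (μ := P) hf.aemeasurable
  have := Measure.isProbabilityMeasure_map (μ := P) hg.aemeasurable
  have := Measure.isProbabilityMeasure_map (μ := P) hh.aemeasurable
  have h3 : IndepFun f g P := h1.comp measurable_id measurable_fst
  rw [indepFun_iff_map_prod_eq_prod_map_map (by fun_prop) (by fun_prop)] at h1 h2 h3 ⊢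
  rw [h3, ← (measurePreserving_prodAssoc (P.map f) (P.map g) (P.map h)).symm.map_eq, ← h2, ← h1,
    Measure.map_map (by fun_prop) (by fun_prop)]
  rfl

-- Iteration `i` uses only the draws of index `i`, so all positions up to time `I` are functions of
-- a common history that excludes `ξ I`.
omit [MeasurableSpace Ω] in
lemma measurable_positions_history {L : Pos d → ℝ} (hL : Measurable L) (ε Lp : ℝ) {n : ℕ}
    (x₀ : Ω → Pos d) (ξ : ℕ → Ω → Noise d n) (I j : ℕ) (hj : j ≤ I) :
    Measurable[MeasurableSpace.comap
      (fun ω => (x₀ ω, fun i : Finset.range I => ξ i ω)) inferInstance]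
      (positions L ε Lp n x₀ ξ j) := by
  induction j with
  | zero => exact measurable_fst.comp (comap_measurable _)
  | succ j ih =>
    have h1 : Measurable fun q : Pos d × (Finset.range I → Noise d n) =>
        q.2 ⟨j, Finset.mem_range.2 hj⟩ := by fun_prop
    exact (measurable_step hL ε Lp n).comp ((ih (by omega)).prodMk
      (h1.comp (comap_measurable (fun ω => (x₀ ω, fun i : Finset.range I => ξ i ω)))))

/-- The σ-algebra of past positions is contained in that of the initial position and earlier draws,
hence independent of the next draw. -/
lemma isMarkovChain_positions (hd : 2 ≤ d) {L : Pos d → ℝ} (hL : Measurable L) (ε Lp : ℝ) {n : ℕ}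
    {x₀ : Ω → Pos d} {ξ : ℕ → Ω → Noise d n} (h : IsInput P x₀ ξ) :
    IsMarkovChain (positions L ε Lp n x₀ ξ) (transition hL ε Lp n) P := by
  have := isMarkovKernel_transition hd hL ε Lp n
  have hξ := h.measurable_noise
  have hW : ∀ I, Measurable fun ω => (x₀ ω, fun i : Finset.range I => ξ i ω) := fun I =>
    h.measurable_init.prodMk (measurable_pi_lambda _ fun i => hξ i)
  have hpos : ∀ i, Measurable (positions L ε Lp n x₀ ξ i) := fun i =>
    (measurable_positions_history hL ε Lp x₀ ξ i i le_rfl).mono (hW i).comap_le le_rfl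
  refine ⟨hpos, fun I A hA => ?_⟩
  have hXm : Measurable[⨆ j ∈ Set.Iic I,
      MeasurableSpace.comap (positions L ε Lp n x₀ ξ j) inferInstance]
      (positions L ε Lp n x₀ ξ I) :=
    Measurable.of_comap_le (le_iSup₂_of_le I (Set.mem_Iic.2 le_rfl) le_rfl)
  refine condExp_indicator_eq (iSup₂_le fun j _ => (hpos j).comap_le) hXm (hξ I)
    (indep_of_indep_of_le_left ?_ (iSup₂_le fun j hj =>
      (measurable_positions_history hL ε Lp x₀ ξ I j hj).comap_le))
    (measurable_step hL ε Lp n) (transition hL ε Lp n)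
    (fun x => by rw [h.map_noise I, transition_apply]) hA
  -- Earlier draws are independent of `ξ I` by disjointness of the index sets; the initial position,
  -- independent of the whole sequence, is then adjoined.
  have h1 : IndepFun (fun ω (i : Finset.range I) => ξ i ω) (ξ I) P :=
    (h.iIndepFun_noise.indepFun_finset (Finset.range I) {I} (by simp) hξ).comp measurable_id
      (measurable_pi_apply (⟨I, Finset.mem_singleton_self I⟩ : ({I} : Finset ℕ)))
  have h2 : Measurable fun q : ℕ → Noise d n =>
      ((fun i : Finset.range I => q i : Finset.range I → Noise d n), q I) := by fun_prop
  exact indepFun_prodMk_left h.measurable_init (measurable_pi_lambda _ fun i => hξ i) (hξ I)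
    (h.indepFun_init.comp measurable_id h2) h1

end MarkovChain

end MAMS

end

theorem theorem2 {d : ℕ} (hd : 2 ≤ d) (L : MAMS.Pos d → ℝ) (hL : Differentiable ℝ L)
    (hint : Integrable (fun x => Real.exp (-L x)))
    {ε Lp : ℝ} (hε : 0 < ε) (hLp : 0 < Lp) (n : ℕ) :
    IsProbabilityMeasure (MAMS.target L) ∧
    ∃ κ : Kernel (MAMS.Pos d) (MAMS.Pos d),
      IsMarkovKernel κ ∧
      (∀ x, κ x = (MAMS.noiseLaw d n).map (MAMS.step L ε Lp n x)) ∧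
      (∀ (Ω : Type*) [MeasurableSpace Ω] (P : Measure Ω) [IsProbabilityMeasure P]
        (x₀ : Ω → MAMS.Pos d) (ξ : ℕ → Ω → MAMS.Noise d n), MAMS.IsInput P x₀ ξ →
          MAMS.IsMarkovChain (MAMS.positions L ε Lp n x₀ ξ) κ P) ∧
      κ.IsReversible (MAMS.target L) ∧
      κ.Invariant (MAMS.target L) := by
  have hLm : Measurable L := hL.continuous.measurable
  have hmk := MAMS.isMarkovKernel_transition hd hLm ε Lp n
  have hrev := MAMS.isReversible_transition hd hLm hε hLp n
  exact ⟨MAMS.isProbabilityMeasure_target hint, MAMS.transition hLm ε Lp n, hmk, fun _ => rfl,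
    fun Ω _ P _ x₀ ξ h => MAMS.isMarkovChain_positions hd hLm ε Lp h, hrev, hrev.invariant⟩
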